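/- Let $X$ be a metric space and $\varepsilon>0$. An $\varepsilon$-chain is a finite sequence $\alpha=\{x_0,\dots,x_n\}$ in $X$ with $d(x_i,x_{i+1})<\varepsilon$ for all $i$; its length is $L(\alpha)=\sum_i d(x_i,x_{i+1})$. A basic move adds or removes one point, keeping the endpoints and the property of being an $\varepsilon$-chain; two $\varepsilon$-chains are $\varepsilon$-homotopic if they are joined by finitely many basic moves. Let $[\alpha]_\varepsilon$ be the $\varepsilon$-homotopy class of $\alpha$ and $|[\alpha]_\varepsilon|$ the infimum of the lengths of the chains in it. An $\varepsilon$-loop is $\varepsilon$-null if it is $\varepsilon$-homotopic to a one-point chain. The homotopy critical spectrum of $X$ is the set of all $\varepsilon>0$ for which some $\varepsilon$-loop is not $\varepsilon$-null but is $\delta$-null for every $\delta>\varepsilon$. For a base point $*\in X$, let $X_\varepsilon$ be the set of all classes $[\alpha]_\varepsilon$ of $\varepsilon$-chains starting at $*$, with the metric $d([\alpha]_\varepsilon,[\beta]_\varepsilon)=|[\overline\alpha*\beta]_\varepsilon|$ ($\overline\alpha$ is the reversed chain, $*$ between chains is concatenation); let $\phi_\varepsilon:X_\varepsilon\to X$ send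 $[\alpha]_\varepsilon$ to the endpoint of $\alpha$; and let $\pi_\varepsilon(X)$ be the group of classes of $\varepsilon$-loops at $*$ under concatenation. For a path $c:[0,1]\to X$ let $|[c]|\in[0,\infty]$ be the infimum of the lengths of the paths in its fixed-endpoint homotopy class $[c]$, and let $\Lambda([c])=[c(t_0),\dots,c(t_n)]_\varepsilon$ for any subdivision $0=t_0<\dots<t_n=1$ with $c([t_i,t_{i+1}])\subset B(c(t_i),\varepsilon)$ for all $i$ (this is well defined). A geodesic space is a metric space in which any two points are joined by an arclength parametrized curve whose length is their distance. A path is locally minimizing if, parametrized proportionally to arclength, it is up to a positive scale factor a local isometry; a closed geodesic is a map from a circle of some length (with its arc metric) to $X$ whose restriction to every sufficiently small arc is an isometry onto its image. **Theorem.** Let $X$ be a compact semilocally simply connected geodesic space. Then the homotopy critical spectrum of $X$ has a positive lower bound. If $\varepsilon>0$ is any such lower bound, then: 1. For every base point, $\phi_\varepsilon:X_\varepsilon\to X$ is the universal covering map of $X$ (a surjective covering map with simply connected total space). 2. $|\Lambda([c])|=|[c]|$ for every path $c$ in $X$ (in particular $|[c]|<\infty$), and for every base point $\Lambda$ restricts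 to a group isomorphism $\pi_1(X)\to\pi_\varepsilon(X)$. 3. For every path $c$ in $X$, the fixed-endpoint homotopy class of $c$ contains a shortest path which is either constant or locally minimizing; moreover every shortest path in the class is constant or a monotone reparametrization of a locally minimizing path. 4. For every path loop $c$ in $X$, the free homotopy class of $c$ contains a shortest loop which is either constant or a closed geodesic; moreover every shortest loop in the class is constant or a monotone reparametrization of a closed geodesic. -/

import Mathlib

open scoped unitInterval ENNReal

namespace DiscreteHomotopy

noncomputable section

/-! ### Chains and their homotopies -/

/-- An `ε`-chain from `x` to `y`: a finite sequence of points `x = x₀, x₁, …, xₙ = y`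
with `dist xᵢ xᵢ₊₁ < ε`. The field `tail` is `x₁, …, xₙ`. -/
@[ext]
structure EpsChain {X : Type*} [MetricSpace X] (ε : ℝ) (x y : X) where
  tail : List X
  isChain : (x :: tail).IsChain (fun a b => dist a b < ε)
  getLast_eq : (x :: tail).getLast (List.cons_ne_nil x tail) = y

/-- `l'` arises from `l` by inserting a single point. -/
def InsertPoint {X : Type*} (l l' : List X) : Prop :=
  ∃ (l₁ l₂ : List X) (p : X), l = l₁ ++ l₂ ∧ l' = l₁ ++ p :: l₂

/-- The length of a finite sequence of points: the sum of the distances of successive points. -/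
def listLength {X : Type*} [MetricSpace X] : List X → ℝ
  | [] => 0
  | [_] => 0
  | a :: b :: l => dist a b + listLength (b :: l)

namespace EpsChain

variable {X : Type*} [MetricSpace X] {ε : ℝ} {x y z : X}

/-- All points `x₀, x₁, …, xₙ` of a chain. -/
def points (α : EpsChain ε x y) : List X := x :: α.tail

/-- The length of a chain. -/
def length (α : EpsChain ε x y) : ℝ := listLength α.points

/-- A basic move: adding or removing a single point, keeping the endpoints. -/
def BasicMove (α β : EpsChain ε x y) : Prop :=
  InsertPoint α.points β.points ∨ InsertPoint β.points α.points

/-- Two `ε`-chains with the same endpoints are `ε`-homotopic if they are joined by a finite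
sequence of `ε`-chains in which successive ones differ by a basic move. -/
def Homotopic (α β : EpsChain ε x y) : Prop := Relation.ReflTransGen BasicMove α β

/-- The chain `{x}`. -/
def single (ε : ℝ) (x : X) : EpsChain ε x x where
  tail := []
  isChain := by simp
  getLast_eq := by simp

/-- The chain `{x, y}`. -/
def pair (h : dist x y < ε) : EpsChain ε x y where
  tail := [y]
  isChain := by simpa using h
  getLast_eq := by simp

/-- An `ε`-loop is `ε`-null if it is `ε`-homotopic to the trivial loop. -/
def IsNull (α : EpsChain ε x x) : Prop := Homotopic α (single ε x)

/-- An `ε`-chain regarded as a `δ`-chain, for `ε ≤ δ`. -/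
def ofLE {δ : ℝ} (h : ε ≤ δ) (α : EpsChain ε x y) : EpsChain δ x y where
  tail := α.tail
  isChain := α.isChain.imp fun _ _ hab => lt_of_lt_of_le hab h
  getLast_eq := α.getLast_eq

/-- Concatenation `{x₀, …, xₙ = y₀, …, yₘ}`. -/
def concat (α : EpsChain ε x y) (β : EpsChain ε y z) : EpsChain ε x z where
  tail := α.tail ++ β.tail
  isChain := by
    rw [← List.cons_append, List.isChain_append]
    refine ⟨α.isChain, β.isChain.tail, ?_⟩
    intro a ha b hb
    have h1 := α.getLast_eq
    rw [List.getLast?_eq_some_getLast (List.cons_ne_nil x α.tail), h1] at ha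
    simp only [Option.mem_def, Option.some.injEq] at ha
    subst ha
    have h2 := β.isChain
    cases ht : β.tail with
    | nil => simp [ht] at hb
    | cons c l =>
      rw [ht] at h2 hb
      simp only [List.head?_cons, Option.mem_def, Option.some.injEq] at hb
      subst hb
      exact (List.isChain_cons_cons.1 h2).1
  getLast_eq := by
    have h1 := α.getLast_eq
    have h2 := β.getLast_eq
    cases ht : β.tail with
    | nil => simp_all
    | cons c l => simp_all

/-- The reversal `{xₙ, …, x₀}`. -/
def reverse (α : EpsChain ε x y) : EpsChain ε y x where
  tail := α.points.reverse.tail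
  isChain := by
    have h : y :: α.points.reverse.tail = α.points.reverse := by
      have h1 := α.getLast_eq
      have h2 : α.points.reverse ≠ [] := by simp [points]
      rw [← List.cons_head_tail h2]
      simp only [List.head_reverse, List.tail_cons]
      simp only [points, h1]
    rw [h, List.isChain_reverse]
    exact α.isChain.imp fun a b hab => by simpa [flip, dist_comm] using hab
  getLast_eq := by
    have h : y :: α.points.reverse.tail = α.points.reverse := by
      have h1 := α.getLast_eq
      have h2 : α.points.reverse ≠ [] := by simp [points]
      rw [← List.cons_head_tail h2]
      simp only [List.head_reverse, List.tail_cons]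
      simp only [points, h1]
    simp only [h, List.getLast_reverse]
    simp [points]

theorem points_reverse (α : EpsChain ε x y) : α.reverse.points = α.points.reverse := by
  have h1 := α.getLast_eq
  have h2 : α.points.reverse ≠ [] := by simp [points]
  rw [← List.cons_head_tail h2]
  simp only [List.head_reverse]
  simp only [points, reverse, h1]

theorem points_concat (α : EpsChain ε x y) (β : EpsChain ε y z) :
    (α.concat β).points = α.points ++ β.tail := rfl

theorem ext_points {α β : EpsChain ε x y} (h : α.points = β.points) : α = β := by
  ext1
  simpa [points] using h

theorem concat_assoc {w : X} (α : EpsChain ε x y) (β : EpsChain ε y z) (γ : EpsChain ε z w) :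
    (α.concat β).concat γ = α.concat (β.concat γ) := by
  ext1
  simp [concat]

theorem single_concat (α : EpsChain ε x y) : (single ε x).concat α = α := by
  ext1
  simp [concat, single]

theorem concat_single (α : EpsChain ε x y) : α.concat (single ε y) = α := by
  ext1
  simp [concat, single]

theorem reverse_reverse (α : EpsChain ε x y) : α.reverse.reverse = α := by
  apply ext_points
  simp [points_reverse]

theorem reverse_concat (α : EpsChain ε x y) (β : EpsChain ε y z) :
    (α.concat β).reverse = β.reverse.concat α.reverse := by
  apply ext_points
  rw [points_reverse, points_concat, points_concat, points_reverse, List.reverse_append]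
  have h : α.reverse.tail = α.points.reverse.tail := rfl
  rw [h]
  have h3 : α.points.reverse = y :: α.points.reverse.tail := by
    rw [← points_reverse]
    rfl
  conv_lhs => rw [h3]
  simp [points]

theorem basicMove_symm {α β : EpsChain ε x y} (h : BasicMove α β) : BasicMove β α := Or.symm h

namespace Homotopic

theorem refl (α : EpsChain ε x y) : Homotopic α α := Relation.ReflTransGen.refl

theorem symm {α β : EpsChain ε x y} (h : Homotopic α β) : Homotopic β α := by
  induction h with
  | refl => exact Relation.ReflTransGen.refl
  | tail _ h ih => exact Relation.ReflTransGen.head (basicMove_symm h) ih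

theorem trans {α β γ : EpsChain ε x y} (h : Homotopic α β) (h' : Homotopic β γ) :
    Homotopic α γ := Relation.ReflTransGen.trans h h'

theorem of_insert {α β : EpsChain ε x y} (h : InsertPoint α.points β.points) :
    Homotopic α β := .single (Or.inl h)

end Homotopic

theorem insert_concat_right {α α' : EpsChain ε x y} (β : EpsChain ε y z)
    (h : InsertPoint α.points α'.points) :
    InsertPoint (α.concat β).points (α'.concat β).points := by
  obtain ⟨l₁, l₂, p, h1, h2⟩ := h
  exact ⟨l₁, l₂ ++ β.tail, p, by simp [points_concat, h1], by simp [points_concat, h2]⟩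

theorem insert_reverse {α α' : EpsChain ε x y} (h : InsertPoint α.points α'.points) :
    InsertPoint α.reverse.points α'.reverse.points := by
  obtain ⟨l₁, l₂, p, h1, h2⟩ := h
  exact ⟨l₂.reverse, l₁.reverse, p, by simp [points_reverse, h1], by simp [points_reverse, h2]⟩

theorem Homotopic.concat_right {α α' : EpsChain ε x y} (h : Homotopic α α')
    (β : EpsChain ε y z) : Homotopic (α.concat β) (α'.concat β) := by
  induction h with
  | refl => exact .refl _
  | tail _ h ih =>
    exact .tail ih (Or.imp (insert_concat_right β) (insert_concat_right β) h)

theorem Homotopic.reverse {α α' : EpsChain ε x y} (h : Homotopic α α') :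
    Homotopic α.reverse α'.reverse := by
  induction h with
  | refl => exact .refl _
  | tail _ h ih => exact .tail ih (Or.imp insert_reverse insert_reverse h)

theorem Homotopic.concat_left (α : EpsChain ε x y) {β β' : EpsChain ε y z}
    (h : Homotopic β β') : Homotopic (α.concat β) (α.concat β') := by
  have := (h.reverse.concat_right α.reverse).reverse
  simpa [← reverse_concat, reverse_reverse] using this

/-- The middle point of `{x, y, z}` may be removed if the result is a chain. -/
theorem pair_concat_pair (hxy : dist x y < ε) (hyz : dist y z < ε) (hxz : dist x z < ε) :
    Homotopic ((pair hxy).concat (pair hyz)) (pair hxz) :=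
  (Homotopic.of_insert ⟨[x], [z], y, rfl, rfl⟩).symm

theorem pair_self (h : dist x x < ε) : Homotopic (pair h) (single ε x) :=
  (Homotopic.of_insert ⟨[x], [], x, rfl, rfl⟩).symm

/-- A chain with at least two points splits off its first step. -/
theorem eq_pair_concat {b : X} {l : List X} (α : EpsChain ε x y) (h : α.tail = b :: l) :
    ∃ (hb : dist x b < ε) (β : EpsChain ε b y), β.tail = l ∧ α = (pair hb).concat β := by
  have h1 := α.isChain
  have h2 := α.getLast_eq
  simp only [h] at h1 h2
  refine ⟨(List.isChain_cons_cons.1 h1).1, ⟨l, (List.isChain_cons_cons.1 h1).2, ?_⟩, rfl, ?_⟩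
  · simpa using h2
  · ext1
    simp [concat, pair, h]

/-- A chain with only one point is trivial. -/
theorem eq_single_of_tail_nil (α : EpsChain ε x x) (h : α.tail = []) : α = single ε x := by
  ext1
  simpa [single] using h

theorem concat_reverse (α : EpsChain ε x y) :
    Homotopic (α.concat α.reverse) (single ε x) := by
  suffices H : ∀ (l : List X) (x : X) (α : EpsChain ε x y), α.tail = l →
      Homotopic (α.concat α.reverse) (single ε x) from H _ x α rfl
  intro l
  induction l with
  | nil =>
    intro x α h
    have h2 := α.getLast_eq
    simp only [h, List.getLast_singleton] at h2
    subst h2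
    rw [eq_single_of_tail_nil α h]
    exact Homotopic.refl _
  | cons b l ih =>
    intro x α h
    obtain ⟨hb, β, hβ, rfl⟩ := eq_pair_concat α h
    have hxx : dist x x < ε := by
      rw [dist_self]
      exact lt_of_le_of_lt dist_nonneg hb
    have hr : (pair hb).reverse = pair (by rwa [dist_comm] : dist b x < ε) := by
      apply ext_points
      rw [points_reverse]
      rfl
    rw [reverse_concat, concat_assoc, ← concat_assoc β]
    refine (((ih b β hβ).concat_right _).concat_left _).trans ?_
    rw [single_concat, hr]
    exact (pair_concat_pair _ _ hxx).trans (pair_self hxx)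

theorem length_nonneg (α : EpsChain ε x y) : 0 ≤ α.length := by
  suffices H : ∀ l : List X, 0 ≤ listLength l from H _
  intro l
  induction l with
  | nil => simp [listLength]
  | cons a l ih =>
    cases l with
    | nil => simp [listLength]
    | cons b l => exact add_nonneg dist_nonneg ih

theorem length_pair_concat (h : dist x y < ε) (α : EpsChain ε y z) :
    ((pair h).concat α).length = dist x y + α.length := rfl

theorem length_concat (α : EpsChain ε x y) (β : EpsChain ε y z) :
    (α.concat β).length = α.length + β.length := by
  suffices H : ∀ (l : List X) (x : X) (α : EpsChain ε x y), α.tail = l →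
      (α.concat β).length = α.length + β.length from H _ x α rfl
  intro l
  induction l with
  | nil =>
    intro x α h
    have h2 := α.getLast_eq
    simp only [h, List.getLast_singleton] at h2
    subst h2
    rw [eq_single_of_tail_nil α h, single_concat]
    simp [length, points, single, listLength]
  | cons b l ih =>
    intro x α h
    obtain ⟨hb, γ, hγ, rfl⟩ := eq_pair_concat α h
    rw [concat_assoc, length_pair_concat, length_pair_concat, ih b γ hγ, add_assoc]

theorem length_reverse (α : EpsChain ε x y) : α.reverse.length = α.length := by
  suffices H : ∀ (l : List X) (x : X) (α : EpsChain ε x y), α.tail = l →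
      α.reverse.length = α.length from H _ x α rfl
  intro l
  induction l with
  | nil =>
    intro x α h
    have h2 := α.getLast_eq
    simp only [h, List.getLast_singleton] at h2
    subst h2
    rw [eq_single_of_tail_nil α h]
    rfl
  | cons b l ih =>
    intro x α h
    obtain ⟨hb, γ, hγ, rfl⟩ := eq_pair_concat α h
    have hr : (pair hb).reverse = pair (by rwa [dist_comm] : dist b x < ε) := by
      apply ext_points
      rw [points_reverse]
      rfl
    rw [reverse_concat, length_concat, ih b γ hγ, hr, length_pair_concat]
    simp [length, points, pair, listLength, dist_comm, add_comm]

theorem dist_le_length (α : EpsChain ε x y) : dist x y ≤ α.length := by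
  suffices H : ∀ (l : List X) (x : X) (α : EpsChain ε x y), α.tail = l →
      dist x y ≤ α.length from H _ x α rfl
  intro l
  induction l with
  | nil =>
    intro x α h
    have h2 := α.getLast_eq
    simp only [h, List.getLast_singleton] at h2
    subst h2
    simpa using α.length_nonneg
  | cons b l ih =>
    intro x α h
    obtain ⟨hb, γ, hγ, rfl⟩ := eq_pair_concat α h
    rw [length_pair_concat]
    exact (dist_triangle x b y).trans (add_le_add le_rfl (ih b γ hγ))

/-- A chain shorter than `ε` is homotopic to the chain of its two endpoints. -/
theorem homotopic_pair (α : EpsChain ε x y) (h : α.length < ε) :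
    Homotopic α (pair (lt_of_le_of_lt α.dist_le_length h)) := by
  suffices H : ∀ (l : List X) (x : X) (α : EpsChain ε x y) (h : α.length < ε), α.tail = l →
      Homotopic α (pair (lt_of_le_of_lt α.dist_le_length h)) from H _ x α h rfl
  intro l
  induction l with
  | nil =>
    intro x α h hl
    have h2 := α.getLast_eq
    simp only [hl, List.getLast_singleton] at h2
    subst h2
    have h3 := eq_single_of_tail_nil α hl
    subst h3
    exact (pair_self _).symm
  | cons b l ih =>
    intro x α h hl
    obtain ⟨hb, γ, hγ, rfl⟩ := eq_pair_concat α hl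
    have h' : γ.length < ε := by
      rw [length_pair_concat] at h
      have := dist_nonneg (x := x) (y := b)
      linarith
    exact ((ih b γ h' hγ).concat_left _).trans (pair_concat_pair _ _ _)

end EpsChain

/-! ### Homotopy classes of chains, the group `π_ε` and the space `X_ε` -/

/-- `ε`-homotopy as an equivalence relation on the `ε`-chains from `x` to `y`. -/
def chainSetoid {X : Type*} [MetricSpace X] (ε : ℝ) (x y : X) : Setoid (EpsChain ε x y) where
  r := EpsChain.Homotopic
  iseqv := ⟨EpsChain.Homotopic.refl, EpsChain.Homotopic.symm, EpsChain.Homotopic.trans⟩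

/-- The set of `ε`-homotopy classes `[α]_ε` of `ε`-chains from `x` to `y`. -/
def ChainClass {X : Type*} [MetricSpace X] (ε : ℝ) (x y : X) : Type _ :=
  Quotient (chainSetoid ε x y)

namespace ChainClass

variable {X : Type*} [MetricSpace X] {ε : ℝ} {w x y z : X}

/-- The class `[α]_ε`. -/
def mk (α : EpsChain ε x y) : ChainClass ε x y := Quotient.mk (chainSetoid ε x y) α

theorem mk_eq_mk {α β : EpsChain ε x y} : mk α = mk β ↔ EpsChain.Homotopic α β :=
  Quotient.eq (r := chainSetoid ε x y)

theorem mk_surjective (a : ChainClass ε x y) : ∃ α : EpsChain ε x y, mk α = a :=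
  Quotient.exists_rep a

/-- The class of the trivial chain. -/
def one (ε : ℝ) (x : X) : ChainClass ε x x := mk (EpsChain.single ε x)

/-- Concatenation of classes. -/
def concat : ChainClass ε x y → ChainClass ε y z → ChainClass ε x z :=
  Quotient.map₂ EpsChain.concat fun _ _ h _ _ h' => (h.concat_right _).trans (h'.concat_left _)

/-- Reversal of classes. -/
def reverse : ChainClass ε x y → ChainClass ε y x :=
  Quotient.map EpsChain.reverse fun _ _ h => h.reverse

/-- `|[α]_ε|`, the infimum of the lengths of the chains in the class. -/
def norm (a : ChainClass ε x y) : ℝ := sInf {r | ∃ γ : EpsChain ε x y, mk γ = a ∧ γ.length = r}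

theorem concat_mk (α : EpsChain ε x y) (β : EpsChain ε y z) :
    concat (mk α) (mk β) = mk (α.concat β) := rfl

theorem reverse_mk (α : EpsChain ε x y) : reverse (mk α) = mk α.reverse := rfl

theorem concat_assoc (a : ChainClass ε w x) (b : ChainClass ε x y) (c : ChainClass ε y z) :
    concat (concat a b) c = concat a (concat b c) := by
  obtain ⟨α, rfl⟩ := mk_surjective a
  obtain ⟨β, rfl⟩ := mk_surjective b
  obtain ⟨γ, rfl⟩ := mk_surjective c
  simp only [concat_mk, EpsChain.concat_assoc]

theorem one_concat (a : ChainClass ε x y) : concat (one ε x) a = a := by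
  obtain ⟨α, rfl⟩ := mk_surjective a
  simp only [one, concat_mk, EpsChain.single_concat]

theorem concat_one (a : ChainClass ε x y) : concat a (one ε y) = a := by
  obtain ⟨α, rfl⟩ := mk_surjective a
  simp only [one, concat_mk, EpsChain.concat_single]

theorem concat_reverse (a : ChainClass ε x y) : concat a (reverse a) = one ε x := by
  obtain ⟨α, rfl⟩ := mk_surjective a
  exact mk_eq_mk.2 α.concat_reverse

theorem reverse_reverse (a : ChainClass ε x y) : reverse (reverse a) = a := by
  obtain ⟨α, rfl⟩ := mk_surjective a
  simp only [reverse_mk, EpsChain.reverse_reverse]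

theorem reverse_concat (a : ChainClass ε x y) (b : ChainClass ε y z) :
    reverse (concat a b) = concat (reverse b) (reverse a) := by
  obtain ⟨α, rfl⟩ := mk_surjective a
  obtain ⟨β, rfl⟩ := mk_surjective b
  simp only [reverse_mk, concat_mk, EpsChain.reverse_concat]

theorem reverse_concat_self (a : ChainClass ε x y) : concat (reverse a) a = one ε y := by
  conv_lhs => rw [← reverse_reverse a, reverse_reverse (reverse a)]
  exact concat_reverse (reverse a)

theorem norm_le_length (α : EpsChain ε x y) : norm (mk α) ≤ α.length :=
  csInf_le ⟨0, by rintro _ ⟨γ, -, rfl⟩; exact γ.length_nonneg⟩ ⟨α, rfl, rfl⟩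

theorem le_norm {a : ChainClass ε x y} {r : ℝ}
    (h : ∀ γ : EpsChain ε x y, mk γ = a → r ≤ γ.length) : r ≤ norm a := by
  obtain ⟨α, hα⟩ := mk_surjective a
  exact le_csInf ⟨_, α, hα, rfl⟩ (by rintro _ ⟨γ, hγ, rfl⟩; exact h γ hγ)

theorem dist_le_norm (a : ChainClass ε x y) : dist x y ≤ norm a :=
  le_norm fun γ _ => γ.dist_le_length

theorem norm_nonneg (a : ChainClass ε x y) : 0 ≤ norm a := dist_nonneg.trans (dist_le_norm a)

theorem norm_one : norm (one ε x) = 0 := by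
  refine le_antisymm ((norm_le_length _).trans ?_) (norm_nonneg _)
  simp [EpsChain.length, EpsChain.points, EpsChain.single, listLength]

theorem norm_reverse_le (a : ChainClass ε x y) : norm (reverse a) ≤ norm a := by
  refine le_norm ?_
  rintro γ rfl
  rw [reverse_mk, ← γ.length_reverse]
  exact norm_le_length _

theorem norm_reverse (a : ChainClass ε x y) : norm (reverse a) = norm a :=
  le_antisymm (norm_reverse_le a) (by simpa [reverse_reverse] using norm_reverse_le (reverse a))

theorem norm_concat_le (a : ChainClass ε x y) (b : ChainClass ε y z) :
    norm (concat a b) ≤ norm a + norm b := by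
  rw [← sub_le_iff_le_add]
  refine le_norm ?_
  rintro α rfl
  rw [sub_le_comm]
  refine le_norm ?_
  rintro β rfl
  rw [sub_le_iff_le_add, add_comm, ← EpsChain.length_concat, concat_mk]
  exact norm_le_length _

theorem eq_one_of_norm_eq_zero (a : ChainClass ε x x) (h : norm a = 0) : a = one ε x := by
  by_cases hε : 0 < ε
  · obtain ⟨γ, hγ, hl⟩ : ∃ γ : EpsChain ε x x, mk γ = a ∧ γ.length < ε := by
      by_contra! hcon
      have := le_norm hcon
      linarith
    subst hγ
    exact mk_eq_mk.2 ((γ.homotopic_pair hl).trans (EpsChain.pair_self _))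
  · obtain ⟨γ, rfl⟩ := mk_surjective a
    cases ht : γ.tail with
    | nil => rw [EpsChain.eq_single_of_tail_nil γ ht]; rfl
    | cons b l =>
      obtain ⟨hb, -⟩ := γ.eq_pair_concat ht
      exact absurd (lt_of_le_of_lt dist_nonneg hb) hε

end ChainClass

/-- The group `π_ε(X, p)`: classes of `ε`-loops at `p`, with the product `[α][β] = [α * β]`
induced by concatenation. -/
abbrev EpsGroup {X : Type*} [MetricSpace X] (ε : ℝ) (p : X) : Type _ := ChainClass ε p p

instance {X : Type*} [MetricSpace X] (ε : ℝ) (p : X) : Group (ChainClass ε p p) where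
  mul := ChainClass.concat
  mul_assoc := ChainClass.concat_assoc
  one := ChainClass.one ε p
  one_mul := ChainClass.one_concat
  mul_one := ChainClass.concat_one
  inv := ChainClass.reverse
  inv_mul_cancel := ChainClass.reverse_concat_self

/-- The space `X_ε` with base point `p`: all classes `[α]_ε` of `ε`-chains starting at `p`,
with arbitrary endpoints. -/
structure EpsCover {X : Type*} [MetricSpace X] (ε : ℝ) (p : X) where
  endpoint : X
  cls : ChainClass ε p endpoint

/-- The endpoint map `φ_ε : X_ε → X`. -/
def endpointMap {X : Type*} [MetricSpace X] (ε : ℝ) (p : X) (a : EpsCover ε p) : X := a.endpoint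

/-- The metric of `X_ε`: the distance of `[α]` and `[β]` is `|[ᾱ * β]|`, where `ᾱ` is the
reversal of `α`. -/
instance {X : Type*} [MetricSpace X] (ε : ℝ) (p : X) : MetricSpace (EpsCover ε p) where
  dist a b := ((a.cls.reverse).concat b.cls).norm
  dist_self a := by
    show ((a.cls.reverse).concat a.cls).norm = 0
    rw [ChainClass.reverse_concat_self, ChainClass.norm_one]
  dist_comm a b := by
    show ((a.cls.reverse).concat b.cls).norm = ((b.cls.reverse).concat a.cls).norm
    rw [← ChainClass.norm_reverse, ChainClass.reverse_concat, ChainClass.reverse_reverse]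
  dist_triangle a b c := by
    show ((a.cls.reverse).concat c.cls).norm ≤
      ((a.cls.reverse).concat b.cls).norm + ((b.cls.reverse).concat c.cls).norm
    refine le_of_eq_of_le ?_ (ChainClass.norm_concat_le _ _)
    rw [ChainClass.concat_assoc, ← ChainClass.concat_assoc b.cls, ChainClass.concat_reverse,
      ChainClass.one_concat]
  eq_of_dist_eq_zero := by
    rintro ⟨y, a⟩ ⟨z, b⟩ h
    change ((a.reverse).concat b).norm = 0 at h
    have hyz : y = z := dist_le_zero.1 (h ▸ ChainClass.dist_le_norm (a.reverse.concat b))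
    subst hyz
    have h1 := ChainClass.eq_one_of_norm_eq_zero _ h
    have h2 : b = a := by
      rw [← ChainClass.one_concat b, ← ChainClass.concat_reverse a, ChainClass.concat_assoc, h1,
        ChainClass.concat_one]
    rw [h2]

/-! ### Homotopy critical values -/

/-- The homotopy critical spectrum: all `ε > 0` for which there is an `ε`-critical `ε`-loop,
that is, one that is not `ε`-null but is `δ`-null for every `δ > ε`. -/
def homotopyCriticalSpectrum (X : Type*) [MetricSpace X] : Set ℝ :=
  {ε | 0 < ε ∧ ∃ (x : X) (α : EpsChain ε x x),
    ¬ α.IsNull ∧ ∀ (δ : ℝ) (h : ε < δ), (α.ofLE h.le).IsNull}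

/-! ### Paths -/

/-- A geodesic space: any two points are joined by an arclength parametrized length minimizing
curve. -/
def IsGeodesicSpace (X : Type*) [MetricSpace X] : Prop :=
  ∀ x y : X, ∃ γ : ℝ → X, γ 0 = x ∧ γ (dist x y) = y ∧
    ∀ s ∈ Set.Icc 0 (dist x y), ∀ t ∈ Set.Icc 0 (dist x y), dist (γ s) (γ t) = |s - t|

/-- Semilocal simple connectedness: every point `x` has a neighbourhood `U` such that each loop
at `x` in `U` is null-homotopic in `X`. -/
def IsSemilocallySimplyConnected (X : Type*) [TopologicalSpace X] : Prop :=
  ∀ x : X, ∃ U ∈ nhds x, ∀ c : Path x x, Set.range c ⊆ U → c.Homotopic (Path.refl x)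

/-- A universal covering map: a surjective covering map with simply connected total space. -/
def IsUniversalCoveringMap {E B : Type*} [TopologicalSpace E] [TopologicalSpace B]
    (f : E → B) : Prop :=
  IsCoveringMap f ∧ Function.Surjective f ∧ SimplyConnectedSpace E

/-- The length of a path (possibly infinite). -/
def pathLength {X : Type*} [MetricSpace X] {x y : X} (c : Path x y) : ℝ≥0∞ :=
  eVariationOn c Set.univ

/-- `|[c]|`, the infimum of the lengths of the paths in a fixed-endpoint homotopy class. -/
def pathClassNorm {X : Type*} [MetricSpace X] {x y : X}
    (q : Path.Homotopic.Quotient x y) : ℝ≥0∞ :=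
  ⨅ (c : Path x y) (_ : Path.Homotopic.Quotient.mk c = q), pathLength c

/-- Free homotopy of loops: a homotopy through loops, with moving base point. -/
def FreelyHomotopic {X : Type*} [TopologicalSpace X] {x y : X} (c : Path x x) (c' : Path y y) :
    Prop :=
  ∃ H : C(I × I, X), (∀ t, H (0, t) = c t) ∧ (∀ t, H (1, t) = c' t) ∧ ∀ s, H (s, 0) = H (s, 1)

/-- `c'` is a shortest path in the fixed-endpoint homotopy class of `c`. -/
def IsShortestInClass {X : Type*} [MetricSpace X] {x y : X} (c c' : Path x y) : Prop :=
  c.Homotopic c' ∧ ∀ c'' : Path x y, c.Homotopic c'' → pathLength c' ≤ pathLength c''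

/-- `c'` is a shortest loop in the free homotopy class of `c`. -/
def IsShortestInFreeClass {X : Type*} [MetricSpace X] {x y : X} (c : Path x x) (c' : Path y y) :
    Prop :=
  FreelyHomotopic c c' ∧
    ∀ (z : X) (c'' : Path z z), FreelyHomotopic c c'' → pathLength c' ≤ pathLength c''

/-- `c` is constant. -/
def IsConstantPath {X : Type*} [TopologicalSpace X] {x y : X} (c : Path x y) : Prop :=
  ∀ t, c t = x

/-- `c` is locally minimizing: for some `ℓ > 0` the curve `s ↦ c (s / ℓ)` on `[0, ℓ]` is locally
an isometric embedding. -/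
def IsLocallyMinimizing {X : Type*} [MetricSpace X] {x y : X} (c : Path x y) : Prop :=
  ∃ ℓ : ℝ, 0 < ℓ ∧ ∀ t : I, ∃ U ∈ nhds t, ∀ s ∈ U, ∀ s' ∈ U,
    dist (c s) (c s') = ℓ * |(s : ℝ) - s'|

/-- `c` is a closed geodesic: it runs once, with constant speed, around a map from a circle of
some length `ℓ > 0`, with its arc metric, that is isometric on all sufficiently small arcs. -/
def IsClosedGeodesic {X : Type*} [MetricSpace X] {x : X} (c : Path x x) : Prop :=
  ∃ ℓ : ℝ, 0 < ℓ ∧ ∃ γ : AddCircle ℓ → X,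
    (∃ δ : ℝ, 0 < δ ∧ ∀ s t : AddCircle ℓ, dist s t < δ → dist (γ s) (γ t) = dist s t) ∧
    ∀ t : I, c t = γ ((ℓ * (t : ℝ) : ℝ) : AddCircle ℓ)

/-- `c` is a (weakly monotone, continuous, surjective) reparametrization of `g`. -/
def IsReparametrization {X : Type*} [TopologicalSpace X] {x y : X} (c g : Path x y) : Prop :=
  ∃ s : I → I, Continuous s ∧ Monotone s ∧ s 0 = 0 ∧ s 1 = 1 ∧ ∀ t, c t = g (s t)

/-! ### The map `Λ` from homotopy classes of paths to homotopy classes of chains -/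

/-- `α = {c(t₀), …, c(tₙ)}` for a subdivision `0 = t₀ < ⋯ < tₙ = 1` such that
`c([tᵢ, tᵢ₊₁])` is contained in the open ball `B(c(tᵢ), ε)` for every `i`. -/
def IsSubdivisionChain {X : Type*} [MetricSpace X] {ε : ℝ} {x y : X} (c : Path x y)
    (α : EpsChain ε x y) : Prop :=
  ∃ (n : ℕ) (t : ℕ → I), t 0 = 0 ∧ t n = 1 ∧ (∀ i < n, t i < t (i + 1)) ∧
    (∀ i < n, ∀ s ∈ Set.Icc (t i) (t (i + 1)), c s ∈ Metric.ball (c (t i)) ε) ∧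
    α.points = (List.range (n + 1)).map fun i => c (t i)

namespace EpsCover

variable {X : Type*} [MetricSpace X] {ε : ℝ} {x : X}

open Classical in
/-- Append the point `z` to a class of chains (if it is closer than `ε` to the endpoint). -/
def snoc (a : EpsCover ε x) (z : X) : EpsCover ε x :=
  if h : dist a.endpoint z < ε then ⟨z, a.cls.concat (ChainClass.mk (EpsChain.pair h))⟩ else a

theorem snoc_eq {a : EpsCover ε x} {z : X} (h : dist a.endpoint z < ε) :
    a.snoc z = ⟨z, a.cls.concat (ChainClass.mk (EpsChain.pair h))⟩ := dif_pos h

theorem snoc_fst {a : EpsCover ε x} {z : X} (h : dist a.endpoint z < ε) : (a.snoc z).endpoint = z := by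
  simp [snoc, h]

theorem snoc_snoc {a : EpsCover ε x} {z w : X} (h : dist a.endpoint z < ε) (h' : dist z w < ε)
    (h'' : dist a.endpoint w < ε) : (a.snoc z).snoc w = a.snoc w := by
  rw [snoc_eq h, snoc_eq h'', snoc_eq (a := ⟨z, _⟩) h', ChainClass.concat_assoc, ChainClass.concat_mk,
    ChainClass.mk_eq_mk.2 (EpsChain.pair_concat_pair h h' h'')]

theorem snoc_self (hε : 0 < ε) {a : EpsCover ε x} {z : X} (h : a.endpoint = z) : a.snoc z = a := by
  subst h
  have h0 : dist a.endpoint a.endpoint < ε := by simpa using hε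
  simp only [snoc, h0, dif_pos]
  have h1 : ChainClass.mk (EpsChain.pair h0) = ChainClass.one ε a.endpoint :=
    ChainClass.mk_eq_mk.2 (EpsChain.pair_self h0)
  rw [h1, ChainClass.concat_one]

/-- The class of the chain `x, f 1, …, f n`. -/
def ofSeq (ε : ℝ) (x : X) (f : ℕ → X) : ℕ → EpsCover ε x
  | 0 => ⟨x, ChainClass.one ε x⟩
  | n + 1 => (ofSeq ε x f n).snoc (f (n + 1))

theorem ofSeq_eq (f : ℕ → X) (h0 : f 0 = x) (n : ℕ) (h : ∀ i < n, dist (f i) (f (i + 1)) < ε) :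
    ∃ α : EpsChain ε x (f n), α.points = (List.range (n + 1)).map f ∧
      ofSeq ε x f n = ⟨f n, ChainClass.mk α⟩ := by
  induction n with
  | zero =>
    subst h0
    exact ⟨EpsChain.single ε _, by simp [EpsChain.points, EpsChain.single], rfl⟩
  | succ n ih =>
    obtain ⟨α, h1, h2⟩ := ih fun i hi => h i (by omega)
    have hn := h n (by omega)
    refine ⟨α.concat (EpsChain.pair hn), ?_, ?_⟩
    · rw [EpsChain.points_concat, h1, List.range_succ (n := n + 1), List.map_append]
      rfl
    · rw [ofSeq, h2]
      simp only [snoc, hn, dif_pos]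
      rfl

theorem ofSeq_fst (f : ℕ → X) (h0 : f 0 = x) (n : ℕ) (h : ∀ i < n, dist (f i) (f (i + 1)) < ε) :
    (ofSeq ε x f n).endpoint = f n := by
  obtain ⟨α, -, h2⟩ := ofSeq_eq f h0 n h
  rw [h2]

end EpsCover

/-- A fine modulus of continuity, in terms of `1 / M`. -/
theorem exists_fine_modulus {X Y : Type*} [MetricSpace X] [MetricSpace Y] [CompactSpace Y] {ε : ℝ}
    (hε : 0 < ε) (c : Y → X) (hc : Continuous c) :
    ∃ M : ℕ, 0 < M ∧ ∀ s t : Y, dist s t ≤ 1 / (M : ℝ) → dist (c s) (c t) < ε := by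
  obtain ⟨δ, hδ, h⟩ := Metric.uniformContinuous_iff.1
    (CompactSpace.uniformContinuous_of_continuous hc) ε hε
  obtain ⟨M, hM⟩ := exists_nat_one_div_lt hδ
  exact ⟨M + 1, by omega, fun s t hst => h (lt_of_le_of_lt hst (by exact_mod_cast hM))⟩

/-- The point `k / M` of the unit interval (capped at `1`). -/
def unitFrac (M k : ℕ) : I := Set.projIcc (0 : ℝ) 1 zero_le_one ((k : ℝ) / M)

theorem coe_unitFrac {M k : ℕ} (hM : 0 < M) (h : k ≤ M) : (unitFrac M k : ℝ) = k / M := by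
  have hM' : (0 : ℝ) < M := by exact_mod_cast hM
  have h' : (k : ℝ) ≤ M := by exact_mod_cast h
  unfold unitFrac
  rw [Set.projIcc_of_mem]
  exact ⟨by positivity, (div_le_one hM').2 h'⟩

theorem unitFrac_zero {M : ℕ} (hM : 0 < M) : unitFrac M 0 = 0 := by
  ext
  simp [coe_unitFrac hM (Nat.zero_le M)]

theorem unitFrac_self {M : ℕ} (hM : 0 < M) : unitFrac M M = 1 := by
  have hM' : (M : ℝ) ≠ 0 := by exact_mod_cast hM.ne'
  ext
  simp [coe_unitFrac hM le_rfl, hM']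

theorem coe_unitFrac_succ {M k : ℕ} (hM : 0 < M) (h : k < M) :
    (unitFrac M (k + 1) : ℝ) = unitFrac M k + 1 / M := by
  rw [coe_unitFrac hM h, coe_unitFrac hM h.le]
  push_cast
  ring

/-- Every path has a subdivision chain, by compactness. -/
theorem exists_isSubdivisionChain {X : Type*} [MetricSpace X] {ε : ℝ} (hε : 0 < ε) {x y : X}
    (c : Path x y) : ∃ α : EpsChain ε x y, IsSubdivisionChain c α := by
  obtain ⟨M, hM, h⟩ := exists_fine_modulus hε c c.continuous
  have hM' : (0 : ℝ) < M := by exact_mod_cast hM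
  have hball : ∀ i < M, ∀ s ∈ Set.Icc (unitFrac M i) (unitFrac M (i + 1)),
      c s ∈ Metric.ball (c (unitFrac M i)) ε := by
    intro i hi s hs
    apply h
    have h1 := coe_unitFrac_succ hM hi
    have h2 : (unitFrac M i : ℝ) ≤ s := hs.1
    have h3 : (s : ℝ) ≤ unitFrac M (i + 1) := hs.2
    rw [Subtype.dist_eq, Real.dist_eq, abs_le]
    constructor <;> linarith [show (0 : ℝ) < 1 / M by positivity]
  have hlt : ∀ i < M, unitFrac M i < unitFrac M (i + 1) := by
    intro i hi
    rw [← Subtype.coe_lt_coe, coe_unitFrac_succ hM hi]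
    linarith [show (0 : ℝ) < 1 / M by positivity]
  obtain ⟨α, hα, -⟩ := EpsCover.ofSeq_eq (ε := ε) (x := x) (fun i => c (unitFrac M i))
    (by simp [unitFrac_zero hM]) M fun i hi => by
      have := hball i hi _ (Set.right_mem_Icc.2 (hlt i hi).le)
      rwa [Metric.mem_ball, dist_comm] at this
  have hy : c (unitFrac M M) = y := by simp [unitFrac_self hM]
  refine ⟨⟨α.tail, α.isChain, α.getLast_eq.trans hy⟩, M, unitFrac M, unitFrac_zero hM,
    unitFrac_self hM, hlt, hball, hα⟩

/-- All sufficiently fine uniform subdivisions of a path give the class of any given subdivision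
chain. -/
theorem mk_eq_ofSeq {X : Type*} [MetricSpace X] {ε : ℝ} {x y : X} (c : Path x y)
    {α : EpsChain ε x y} (hα : IsSubdivisionChain c α) (hε : 0 < ε) {M : ℕ} (hM : 0 < M)
    (h : ∀ s t : I, dist s t ≤ 1 / (M : ℝ) → dist (c s) (c t) < ε) :
    (⟨y, ChainClass.mk α⟩ : EpsCover ε x) =
      EpsCover.ofSeq ε x (fun i => c (unitFrac M i)) M := by
  have hM' : (0 : ℝ) < M := by exact_mod_cast hM
  obtain ⟨n, t, ht0, htn, hlt, hball, hpts⟩ := hα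
  have hd : ∀ s t : I, |(s : ℝ) - t| ≤ 1 / M → dist (c s) (c t) < ε := h
  set K : ℕ → EpsCover ε x := EpsCover.ofSeq ε x (fun i => c (unitFrac M i)) with hK
  have hstep : ∀ i < M, dist (c (unitFrac M i)) (c (unitFrac M (i + 1))) < ε := by
    intro i hi
    apply hd
    rw [coe_unitFrac_succ hM hi, sub_add_cancel_left, abs_neg, abs_of_pos (by positivity)]
  have hKfst : ∀ i ≤ M, (K i).endpoint = c (unitFrac M i) := fun i hi =>
    EpsCover.ofSeq_fst _ (by simp [unitFrac_zero hM]) i fun j hj => hstep j (by omega)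
  have hKsucc : ∀ i, K (i + 1) = (K i).snoc (c (unitFrac M (i + 1))) := fun i => rfl
  -- the grid index just below `s`
  let fl : I → ℕ := fun s => ⌊(s : ℝ) * M⌋₊
  have hfl_le : ∀ s : I, (fl s : ℝ) ≤ s * M := fun s =>
    Nat.floor_le (mul_nonneg s.2.1 hM'.le)
  have hfl_lt : ∀ s : I, (s : ℝ) * M < fl s + 1 := fun s => Nat.lt_floor_add_one _
  have hflM : ∀ s : I, fl s ≤ M := by
    intro s
    have h1 := hfl_le s
    have h2 : (s : ℝ) * M ≤ 1 * M := mul_le_mul_of_nonneg_right s.2.2 hM'.le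
    exact_mod_cast (h1.trans h2).trans_eq (one_mul _)
  have hfl_le' : ∀ s : I, (unitFrac M (fl s) : ℝ) ≤ s := fun s => by
    rw [coe_unitFrac hM (hflM s), div_le_iff₀ hM']
    exact hfl_le s
  have hfl_lt' : ∀ s : I, (s : ℝ) < unitFrac M (fl s) + 1 / M := fun s => by
    rw [coe_unitFrac hM (hflM s), ← add_div, lt_div_iff₀ hM']
    exact hfl_lt s
  let U : I → EpsCover ε x := fun s => (K (fl s)).snoc (c s)
  have hUstep : ∀ s, dist (K (fl s)).endpoint (c s) < ε := by
    intro s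
    rw [hKfst _ (hflM s)]
    apply hd
    rw [abs_le]
    constructor <;> linarith [hfl_le' s, hfl_lt' s]
  have hUfst : ∀ s, (U s).endpoint = c s := fun s => EpsCover.snoc_fst (hUstep s)
  have key : ∀ u v : I, u ≤ v → (∀ s ∈ Set.Icc u v, c s ∈ Metric.ball (c u) ε) →
      U v = (U u).snoc (c v) := by
    intro u v huv hb
    have hb' : ∀ s ∈ Set.Icc u v, dist (U u).endpoint (c s) < ε := by
      intro s hs
      rw [hUfst, dist_comm]
      exact hb s hs
    have huv' : (u : ℝ) ≤ v := huv
    have hfle : fl u ≤ fl v := Nat.floor_mono (mul_le_mul_of_nonneg_right huv' hM'.le)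
    have hcuv : dist (c u) (c v) < ε := by
      rw [← hUfst u]
      exact hb' v (Set.right_mem_Icc.2 huv)
    rcases hfle.eq_or_lt with heq | hlt'
    · have h1 := hUstep v
      rw [← heq] at h1
      show (K (fl v)).snoc (c v) = ((K (fl u)).snoc (c u)).snoc (c v)
      rw [EpsCover.snoc_snoc (hUstep u) hcuv h1, heq]
    · have hgrid : ∀ j, fl u + 1 ≤ j → j ≤ fl v → unitFrac M j ∈ Set.Icc u v := by
        intro j hj1 hj2
        have hjM : j ≤ M := hj2.trans (hflM v)
        have hj1' : (fl u : ℝ) + 1 ≤ j := by exact_mod_cast hj1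
        have hj2' : (j : ℝ) ≤ fl v := by exact_mod_cast hj2
        constructor
        · rw [← Subtype.coe_le_coe, coe_unitFrac hM hjM, le_div_iff₀ hM']
          linarith [hfl_lt u]
        · rw [← Subtype.coe_le_coe, coe_unitFrac hM hjM, div_le_iff₀ hM']
          linarith [hfl_le v]
      have hind : ∀ j, fl u + 1 ≤ j → j ≤ fl v → K j = (U u).snoc (c (unitFrac M j)) := by
        intro j hj1
        induction j, hj1 using Nat.le_induction with
        | base =>
          intro hj2
          have huM : fl u < M := lt_of_lt_of_le hlt' (hflM v)
          have hmem := hgrid _ le_rfl hj2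
          have h1 : dist (c u) (c (unitFrac M (fl u + 1))) < ε := by
            rw [← hUfst u]
            exact hb' _ hmem
          have h2 : dist (K (fl u)).endpoint (c (unitFrac M (fl u + 1))) < ε := by
            rw [hKfst _ huM.le]
            exact hstep _ huM
          exact (EpsCover.snoc_snoc (hUstep u) h1 h2).symm
        | succ j hj1 ih =>
          intro hj2
          have hjM : j < M := lt_of_lt_of_le hj2 (hflM v)
          rw [hKsucc, ih (by omega)]
          exact EpsCover.snoc_snoc (hb' _ (hgrid j hj1 (by omega))) (hstep j hjM)
            (hb' _ (hgrid (j + 1) (by omega) hj2))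
      show (K (fl v)).snoc (c v) = _
      rw [hind (fl v) hlt' le_rfl]
      refine EpsCover.snoc_snoc (hb' _ (hgrid (fl v) hlt' le_rfl)) ?_
        (hb' v (Set.right_mem_Icc.2 huv))
      have h1 := hUstep v
      rwa [hKfst _ (hflM v)] at h1
  have hseq : ∀ i ≤ n, EpsCover.ofSeq ε x (fun i => c (t i)) i = U (t i) := by
    intro i
    induction i with
    | zero =>
      intro _
      have h0 : fl 0 = 0 := by simp [fl]
      show (⟨x, ChainClass.one ε x⟩ : EpsCover ε x) = (K (fl (t 0))).snoc (c (t 0))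
      rw [ht0, h0, EpsCover.snoc_self hε]
      · rfl
      · rw [c.source]
        rfl
    | succ i ih =>
      intro hi
      rw [EpsCover.ofSeq, ih (by omega)]
      exact (key _ _ (hlt i hi).le (hball i hi)).symm
  have hα' : (⟨y, ChainClass.mk α⟩ : EpsCover ε x) =
      EpsCover.ofSeq ε x (fun i => c (t i)) n := by
    obtain ⟨β, hβ1, hβ2⟩ := EpsCover.ofSeq_eq (ε := ε) (x := x) (fun i => c (t i))
      (by simp [ht0]) n fun i hi => by
        have := hball i hi _ (Set.right_mem_Icc.2 (hlt i hi).le)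
        rwa [Metric.mem_ball, dist_comm] at this
    have aux : ∀ (w : X) (β : EpsChain ε x w), w = y → β.points = α.points →
        (⟨y, ChainClass.mk α⟩ : EpsCover ε x) = ⟨w, ChainClass.mk β⟩ := by
      rintro w β rfl hβ
      rw [EpsChain.ext_points hβ]
    rw [hβ2]
    exact aux _ β (by simp [htn]) (hβ1.trans hpts.symm)
  rw [hα', hseq n le_rfl, htn]
  have h1 : fl 1 = M := by simp [fl]
  show (K (fl 1)).snoc (c 1) = K M
  rw [h1]
  apply EpsCover.snoc_self hε
  rw [hKfst M le_rfl, unitFrac_self hM]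

/-- Subdivision chains of homotopic paths are homotopic. -/
theorem homotopic_of_isSubdivisionChain {X : Type*} [MetricSpace X] {ε : ℝ} {x y : X}
    {c c' : Path x y} {α α' : EpsChain ε x y} (hε : 0 < ε) (h : c.Homotopic c')
    (hα : IsSubdivisionChain c α) (hα' : IsSubdivisionChain c' α') :
    α.Homotopic α' := by
  obtain ⟨H⟩ := h
  obtain ⟨M, hM, hd⟩ := exists_fine_modulus hε H H.continuous
  have hM' : (0 : ℝ) < M := by exact_mod_cast hM
  have hdist : ∀ i < M, dist (unitFrac M i) (unitFrac M (i + 1)) ≤ 1 / (M : ℝ) := by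
    intro i hi
    rw [Subtype.dist_eq, Real.dist_eq, coe_unitFrac_succ hM hi, sub_add_cancel_left, abs_neg,
      abs_of_pos (by positivity)]
  let V : ℕ → ℕ → EpsCover ε x := fun j =>
    EpsCover.ofSeq ε x fun k => H (unitFrac M j, unitFrac M k)
  have hrow : ∀ j, ∀ k < M,
      dist (H (unitFrac M j, unitFrac M k)) (H (unitFrac M j, unitFrac M (k + 1))) < ε := by
    intro j k hk
    apply hd
    rw [Prod.dist_eq]
    exact max_le (by simp) (hdist k hk)
  have hVfst : ∀ j, ∀ k ≤ M, (V j k).endpoint = H (unitFrac M j, unitFrac M k) := fun j k hk =>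
    EpsCover.ofSeq_fst _ (by simp [unitFrac_zero hM]) k fun i hi => hrow j i (by omega)
  have hV : ∀ j < M, ∀ k ≤ M,
      V (j + 1) k = (V j k).snoc (H (unitFrac M (j + 1), unitFrac M k)) := by
    intro j hj k
    induction k with
    | zero =>
      intro _
      rw [EpsCover.snoc_self hε]
      · rfl
      · rw [hVfst j 0 (by omega), unitFrac_zero hM]
        simp
    | succ k ih =>
      intro hk
      have hcol : ∀ k, dist (H (unitFrac M j, unitFrac M k))
          (H (unitFrac M (j + 1), unitFrac M k)) < ε := by
        intro k
        apply hd
        rw [Prod.dist_eq]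
        exact max_le (hdist j hj) (by simp)
      have hdiag : dist (H (unitFrac M j, unitFrac M k))
          (H (unitFrac M (j + 1), unitFrac M (k + 1))) < ε := by
        apply hd
        rw [Prod.dist_eq]
        exact max_le (hdist j hj) (hdist k hk)
      have e1 : V (j + 1) (k + 1) =
        (V (j + 1) k).snoc (H (unitFrac M (j + 1), unitFrac M (k + 1))) := rfl
      have e2 : V j (k + 1) = (V j k).snoc (H (unitFrac M j, unitFrac M (k + 1))) := rfl
      rw [e1, ih (by omega), e2, EpsCover.snoc_snoc, EpsCover.snoc_snoc]
      all_goals try rw [hVfst j k (by omega)]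
      · exact hrow j k hk
      · exact hcol (k + 1)
      · exact hdiag
      · exact hcol k
      · exact hrow (j + 1) k hk
      · exact hdiag
  have hcol : ∀ j ≤ M, V j M = V 0 M := by
    intro j
    induction j with
    | zero => intro _; rfl
    | succ j ih =>
      intro hj
      rw [hV j hj M le_rfl, EpsCover.snoc_self hε, ih (by omega)]
      rw [hVfst j M le_rfl, unitFrac_self hM]
      simp
  have hmod : ∀ j, ∀ s t : I, dist s t ≤ 1 / (M : ℝ) →
      dist (H (unitFrac M j, s)) (H (unitFrac M j, t)) < ε := by
    intro j s t hst
    apply hd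
    rw [Prod.dist_eq]
    exact max_le (by simp) hst
  have hm0 := hmod 0
  have hm1 := hmod M
  have hc := hcol M le_rfl
  simp only [V, unitFrac_zero hM, unitFrac_self hM, ContinuousMap.HomotopyWith.apply_zero,
    ContinuousMap.HomotopyWith.apply_one] at hm0 hm1 hc
  have e0 := mk_eq_ofSeq c hα hε hM hm0
  have e1 := mk_eq_ofSeq c' hα' hε hM hm1
  have e2 : (⟨y, ChainClass.mk α⟩ : EpsCover ε x) = ⟨y, ChainClass.mk α'⟩ :=
    e0.trans (hc.symm.trans e1.symm)
  exact ChainClass.mk_eq_mk.1 (eq_of_heq (EpsCover.mk.inj e2).2)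

/-- The map `Λ`: it sends `[c]` to `[c(t₀), …, c(tₙ)]_ε` for any sufficiently fine subdivision
of `[0, 1]`; see `chainMap_mk` for the independence of all choices. -/
def chainMap {X : Type*} [MetricSpace X] {ε : ℝ} (hε : 0 < ε) {x y : X}
    (q : Path.Homotopic.Quotient x y) : ChainClass ε x y :=
  Quotient.liftOn q (fun c => ChainClass.mk (exists_isSubdivisionChain hε c).choose)
    fun c c' h => ChainClass.mk_eq_mk.2 <| homotopic_of_isSubdivisionChain hε h
      (exists_isSubdivisionChain hε c).choose_spec (exists_isSubdivisionChain hε c').choose_spec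

theorem chainMap_mk {X : Type*} [MetricSpace X] {ε : ℝ} (hε : 0 < ε) {x y : X} (c : Path x y)
    (α : EpsChain ε x y) (hα : IsSubdivisionChain c α) :
    chainMap hε (Path.Homotopic.Quotient.mk c) = ChainClass.mk α :=
  ChainClass.mk_eq_mk.2 <| homotopic_of_isSubdivisionChain hε (Path.Homotopic.refl c)
      (exists_isSubdivisionChain hε c).choose_spec hα

end

end DiscreteHomotopy

open DiscreteHomotopy

/-! Everything rests on comparing chains with geodesic polygons. Semilocal simple connectedness,
compactness and geodesics give an `r > 0` such that every loop inside an `r`-ball is null-homotopic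
in `X` (`exists_loopsNullInBalls`). Joining the successive points of a chain by geodesics gives a
polygon no longer than the chain. A vertex whose two adjacent sides have total length below `r` can
be inserted or deleted without changing the class of the polygon, so at scales up to `r / 2`
homotopic chains have homotopic polygons (`trace_eq_of_homotopic`).

At every scale `Λ` sends a polygon back to the class of its chain of vertices (`chainMap_trace`),
hence `Λ` is surjective. A loop that is `r / 2`-null has a null-homotopic polygon, and applying `Λ`
at a smaller scale shows that it is null there too; so no critical value lies below `r / 2`. If `ε`
is any lower bound of the spectrum and `δ ≤ ε`, a `δ`-loop that is `ε`-null is `δ`-null, since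
otherwise the supremum of the scales at which it is not null would be a critical value below `ε`
(`isNull_of_lowerBounds`). Thus homotopies descend from `ε` to a scale where polygons are rigid, and
`Λ` is injective (`chainMap_injective`). Equality of norms follows because subdividing a path and
filling in a chain both do not increase length.

Classes at distance less than `ε` in `X_ε` differ by one step of the chain, so `φ_ε` is a covering
over `ε`-balls. A path in `X_ε` is determined at its end by its start and the `Λ` of its image;
injectivity of `Λ` then makes `X_ε` simply connected.

Shortest paths and loops are found among polygons with a fixed number of vertices and sides at most
`r / 4`: these form a compact set, nearby polygons are homotopic, and length is continuous.
Replacing a short piece of a minimizer by a geodesic stays in the class, so short pieces realize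
distances. For free homotopy classes the same replacement across the base point shows that the loop
closes up to a closed geodesic. -/

namespace DiscreteHomotopy

/-! ### Lengths of paths -/

section Length

variable {X : Type*} [MetricSpace X] {x y z : X}

theorem eVariationOn_le_of_lipschitz (c : I → X) {K : ℝ} (hK : 0 ≤ K)
    (h : ∀ s t : I, dist (c s) (c t) ≤ K * |(s : ℝ) - t|) {u v : I} (huv : u ≤ v) :
    eVariationOn c (Set.Icc u v) ≤ ENNReal.ofReal (K * ((v : ℝ) - u)) := by
  -- Extending `c` to the real line writes it as a Lipschitz map composed with the monotone
  -- inclusion of the interval, whose variation is known.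
  have h1 : LipschitzOnWith K.toNNReal (fun t : ℝ => c (Set.projIcc 0 1 zero_le_one t))
      (Set.Icc 0 1) := by
    refine LipschitzOnWith.of_dist_le_mul fun s hs t ht => ?_
    rw [Set.projIcc_of_mem _ hs, Set.projIcc_of_mem _ ht, Real.coe_toNNReal _ hK, Real.dist_eq]
    exact h _ _
  have h2 := h1.comp_eVariationOn_le (g := fun t : I => (t : ℝ)) (s := Set.Icc u v)
    fun t _ => t.2
  have h3 : ((fun t : ℝ => c (Set.projIcc 0 1 zero_le_one t)) ∘ fun t : I => (t : ℝ)) = c := by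
    funext t
    simp
  rw [h3] at h2
  have h4 : eVariationOn (fun t : I => (t : ℝ)) (Set.Icc u v) ≤ ENNReal.ofReal ((v : ℝ) - u) := by
    have := MonotoneOn.eVariationOn_eq (f := fun t : I => (t : ℝ)) (s := Set.Icc u v) (a := u)
      (b := v) (fun a _ b _ hab => hab) ⟨le_rfl, huv⟩ ⟨huv, le_rfl⟩
    rw [Set.inter_self] at this
    exact this.le
  refine h2.trans ?_
  rw [ENNReal.ofReal_mul hK]
  exact mul_le_mul_right h4 _

theorem univ_eq_Icc : (Set.univ : Set I) = Set.Icc 0 1 := by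
  ext t
  exact ⟨fun _ => ⟨t.2.1, t.2.2⟩, fun _ => trivial⟩

theorem pathLength_eq (c : Path x y) : pathLength c = eVariationOn c (Set.Icc 0 1) := by
  rw [pathLength, univ_eq_Icc]

theorem pathLength_le_of_lipschitz (c : Path x y) {K : ℝ} (hK : 0 ≤ K)
    (h : ∀ s t : I, dist (c s) (c t) ≤ K * |(s : ℝ) - t|) :
    pathLength c ≤ ENNReal.ofReal K := by
  rw [pathLength_eq]
  simpa using eVariationOn_le_of_lipschitz c hK h (zero_le_one' I)

theorem pathLength_subpath (c : Path x y) {s t : I} (hst : s ≤ t) :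
    pathLength (c.subpath s t) = eVariationOn c (Set.Icc s t) := by
  have h : Monotone (Set.Icc.convexComb s t) := by
    intro a b hab
    rw [← Subtype.coe_le_coe, Set.Icc.coe_convexComb, Set.Icc.coe_convexComb]
    have h1 : (s : ℝ) ≤ t := hst
    have h2 : (a : ℝ) ≤ b := hab
    nlinarith
  show eVariationOn (c ∘ Set.Icc.convexComb s t) Set.univ = _
  rw [eVariationOn.comp_eq_of_monotoneOn _ _ (h.monotoneOn _), Set.image_univ,
    Path.range_subpathAux, Set.uIcc_of_le hst]

theorem eVariationOn_add (c : I → X) {s t u : I} (hst : s ≤ t) (htu : t ≤ u) :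
    eVariationOn c (Set.Icc s t) + eVariationOn c (Set.Icc t u) = eVariationOn c (Set.Icc s u) := by
  have := eVariationOn.Icc_add_Icc c (s := Set.univ) hst htu (Set.mem_univ _)
  simpa using this

theorem edist_le_eVariationOn (c : I → X) {s t : I} (hst : s ≤ t) :
    edist (c s) (c t) ≤ eVariationOn c (Set.Icc s t) :=
  eVariationOn.edist_le c ⟨le_rfl, hst⟩ ⟨hst, le_rfl⟩

theorem pathLength_trans (c : Path x y) (d : Path y z) :
    pathLength (c.trans d) = pathLength c + pathLength d := by
  let h : I := ⟨1 / 2, by norm_num, by norm_num⟩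
  have hc : pathLength c = pathLength ((c.trans d).subpath 0 h) := by
    show eVariationOn _ _ = eVariationOn _ _
    congr 1
    funext t
    show c t = (c.trans d) (Set.Icc.convexComb 0 h t)
    have h1 : ((Set.Icc.convexComb 0 h t : I) : ℝ) = t / 2 := by
      rw [Set.Icc.coe_convexComb]; simp [h]; ring
    have h2 : (t : ℝ) ≤ 1 := t.2.2
    rw [Path.trans_apply, dif_pos (by rw [h1]; linarith)]
    congr 1
    ext
    simp only [h1]
    ring
  have hd : pathLength d = pathLength ((c.trans d).subpath h 1) := by
    show eVariationOn _ _ = eVariationOn _ _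
    congr 1
    funext t
    show d t = (c.trans d) (Set.Icc.convexComb h 1 t)
    have h1 : ((Set.Icc.convexComb h 1 t : I) : ℝ) = 1 / 2 + t / 2 := by
      rw [Set.Icc.coe_convexComb]; simp [h]; ring
    have h2 : (0 : ℝ) ≤ t := t.2.1
    rw [Path.trans_apply]
    split_ifs with h3
    -- At the midpoint the concatenation is evaluated by its first branch; there the two paths agree
    -- at the common endpoint `y`.
    · have h4 : t = 0 := Subtype.ext (le_antisymm (by rw [h1] at h3; show (t : ℝ) ≤ 0; linarith) h2)
      subst h4
      rw [d.source]
      have : (⟨2 * ((Set.Icc.convexComb h 1 0 : I) : ℝ),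
        (unitInterval.mul_pos_mem_iff zero_lt_two).2
          ⟨(Set.Icc.convexComb h 1 0).2.1, h3⟩⟩ : I) = 1 := by
        ext
        simp only [h1]
        simp
      rw [this, c.target]
    · congr 1
      ext
      simp only [h1]
      ring
  have h0 : (0 : I) ≤ h := h.2.1
  have h1 : h ≤ (1 : I) := h.2.2
  rw [hc, hd, pathLength_subpath _ h0, pathLength_subpath _ h1, eVariationOn_add _ h0 h1,
    pathLength_eq]

theorem isConstantPath_of_pathLength_eq_zero (c : Path x y) (h : pathLength c = 0) :
    IsConstantPath c := by
  intro t
  have h1 : edist (c 0) (c t) ≤ pathLength c := eVariationOn.edist_le _ (Set.mem_univ _)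
    (Set.mem_univ _)
  rw [h, nonpos_iff_eq_zero, edist_eq_zero, c.source] at h1
  exact h1.symm

end Length

/-! ### Geodesics and small loops -/

section Geodesic

variable {X : Type*} [MetricSpace X]

theorem IsGeodesicSpace.exists_path (hgeo : IsGeodesicSpace X) (x y : X) :
    ∃ c : Path x y, ∀ s t : I, dist (c s) (c t) = dist x y * |(s : ℝ) - t| := by
  obtain ⟨γ, h0, h1, h⟩ := hgeo x y
  have hmem : ∀ t : I, dist x y * (t : ℝ) ∈ Set.Icc 0 (dist x y) := fun t =>
    ⟨mul_nonneg dist_nonneg t.2.1, mul_le_of_le_one_right dist_nonneg t.2.2⟩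
  have hd : ∀ s t : I, dist (γ (dist x y * s)) (γ (dist x y * t)) = dist x y * |(s : ℝ) - t| := by
    intro s t
    rw [h _ (hmem s) _ (hmem t), ← mul_sub, abs_mul, abs_of_nonneg dist_nonneg]
  refine ⟨⟨⟨fun t => γ (dist x y * t), ?_⟩, by simp [h0], by simp [h1]⟩, hd⟩
  refine (LipschitzWith.of_dist_le_mul (K := (dist x y).toNNReal) fun s t => ?_).continuous
  rw [hd, Real.coe_toNNReal _ dist_nonneg, Subtype.dist_eq, Real.dist_eq]

/-- A constant speed geodesic. -/
noncomputable def IsGeodesicSpace.path (hgeo : IsGeodesicSpace X) (x y : X) : Path x y :=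
  (hgeo.exists_path x y).choose

variable (hgeo : IsGeodesicSpace X) {r : ℝ}

theorem IsGeodesicSpace.dist_path (x y : X) (s t : I) :
    dist (hgeo.path x y s) (hgeo.path x y t) = dist x y * |(s : ℝ) - t| :=
  (hgeo.exists_path x y).choose_spec s t

theorem IsGeodesicSpace.dist_source_path (x y : X) (t : I) :
    dist x (hgeo.path x y t) ≤ dist x y := by
  have h := hgeo.dist_path x y 0 t
  rw [Path.source] at h
  rw [h]
  refine mul_le_of_le_one_right dist_nonneg ?_
  have h1 := t.2.1
  have h2 := t.2.2
  rw [abs_le]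
  constructor <;> simp <;> linarith

theorem IsGeodesicSpace.path_self (x : X) : hgeo.path x x = Path.refl x := by
  ext t
  have h := hgeo.dist_source_path x x t
  rw [dist_self] at h
  exact (dist_le_zero.1 h).symm

theorem IsGeodesicSpace.range_path_subset {x y z : X} (h : dist z x + dist x y < r) :
    Set.range (hgeo.path x y) ⊆ Metric.ball z r := by
  rintro _ ⟨t, rfl⟩
  rw [Metric.mem_ball, dist_comm]
  have := hgeo.dist_source_path x y t
  have := dist_triangle z x (hgeo.path x y t)
  linarith

theorem IsGeodesicSpace.pathLength_path_le (x y : X) :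
    pathLength (hgeo.path x y) ≤ ENNReal.ofReal (dist x y) :=
  pathLength_le_of_lipschitz _ dist_nonneg fun s t => (hgeo.dist_path x y s t).le

/-- All loops that stay in a ball of radius `r` are null-homotopic. -/
def LoopsNullInBalls (X : Type*) [MetricSpace X] (r : ℝ) : Prop :=
  ∀ (z x : X) (c : Path x x), Set.range c ⊆ Metric.ball z r → c.Homotopic (Path.refl x)

theorem quotient_eq_of_trans_symm {Y : Type*} [TopologicalSpace Y] {x y : Y}
    {p q : Path.Homotopic.Quotient x y} (h : p.trans q.symm = .refl x) : p = q := by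
  calc p = (p.trans q.symm).trans q := by simp
    _ = q := by rw [h]; simp

theorem range_trans_subset {Y : Type*} [TopologicalSpace Y] {x y z : Y} {c : Path x y}
    {d : Path y z} {s : Set Y} (hc : Set.range c ⊆ s) (hd : Set.range d ⊆ s) :
    Set.range (c.trans d) ⊆ s := by
  rw [Path.trans_range]
  exact Set.union_subset hc hd

theorem LoopsNullInBalls.homotopic (hr : LoopsNullInBalls X r) {x y z : X} {c d : Path x y}
    (hc : Set.range c ⊆ Metric.ball z r) (hd : Set.range d ⊆ Metric.ball z r) :
    c.Homotopic d := by
  have := hr z x (c.trans d.symm) (range_trans_subset hc (by rwa [Path.symm_range]))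
  rw [← Path.Homotopic.Quotient.eq] at this ⊢
  exact quotient_eq_of_trans_symm (by simpa using this)

/-- The hypothesis concerns only loops based at the centre of a neighbourhood. A geodesic from the
centre to a point of a ball stays in the ball, so conjugating by it reaches every base point; a
Lebesgue number of the resulting cover makes the radius uniform. -/
theorem exists_loopsNullInBalls [CompactSpace X] (hgeo : IsGeodesicSpace X)
    (hslsc : IsSemilocallySimplyConnected X) : ∃ r : ℝ, 0 < r ∧ LoopsNullInBalls X r := by
  have h1 : ∀ x : X, ∃ r : ℝ, 0 < r ∧ ∀ (w : X) (c : Path w w),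
      Set.range c ⊆ Metric.ball x r → c.Homotopic (Path.refl w) := by
    intro x
    obtain ⟨U, hU, h⟩ := hslsc x
    obtain ⟨r, hr, hrU⟩ := Metric.mem_nhds_iff.1 hU
    refine ⟨r, hr, fun w c hc => ?_⟩
    have hw : dist w x < r := hc ⟨0, c.source⟩
    set e := hgeo.path x w
    have he : Set.range e ⊆ Metric.ball x r :=
      hgeo.range_path_subset (by rw [dist_self, zero_add, dist_comm]; exact hw)
    have h2 := h ((e.trans c).trans e.symm) (subset_trans (range_trans_subset
      (range_trans_subset he hc) (by rwa [Path.symm_range])) hrU)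
    rw [← Path.Homotopic.Quotient.eq] at h2 ⊢
    simp only [Path.Homotopic.Quotient.mk_trans, Path.Homotopic.Quotient.mk_symm,
      Path.Homotopic.Quotient.mk_refl] at h2 ⊢
    have h3 := quotient_eq_of_trans_symm h2
    calc _ = (Path.Homotopic.Quotient.mk e).symm.trans
          ((Path.Homotopic.Quotient.mk e).trans (.mk c)) := by
            rw [← Path.Homotopic.Quotient.trans_assoc]; simp
      _ = _ := by rw [h3]; simp
  choose ρ hρ hnull using h1
  obtain ⟨r, hr, h⟩ := lebesgue_number_lemma_of_metric (s := (Set.univ : Set X))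
    (c := fun x => Metric.ball x (ρ x)) isCompact_univ (fun _ => Metric.isOpen_ball)
    fun x _ => Set.mem_iUnion.2 ⟨x, Metric.mem_ball_self (hρ x)⟩
  refine ⟨r, hr, fun z x c hc => ?_⟩
  obtain ⟨i, hi⟩ := h z (Set.mem_univ z)
  exact hnull i x c (hc.trans hi)

end Geodesic

/-! ### Polygons of geodesics and their homotopy classes -/

/-- Homotopy classes of paths starting at `p`, with arbitrary endpoints. -/
structure PathCover {X : Type*} [TopologicalSpace X] (p : X) where
  endpoint : X
  cls : Path.Homotopic.Quotient p endpoint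

namespace PathCover

section

variable {X : Type*} [MetricSpace X] (hgeo : IsGeodesicSpace X) {r : ℝ} {p x y z : X}

theorem mk_eq_mk_iff {q q' : Path.Homotopic.Quotient x y} :
    (⟨y, q⟩ : PathCover x) = ⟨y, q'⟩ ↔ q = q' :=
  ⟨fun h => eq_of_heq (PathCover.mk.inj h).2, fun h => h ▸ rfl⟩

/-- Bundling the endpoint with the class makes paths comparable whose endpoints agree only
propositionally, without transporting along equalities. -/
theorem mk_eq_mk_of_apply_eq {c : Path x y} {c' : Path x z} (h : ∀ t, c t = c' t) :
    (⟨y, .mk c⟩ : PathCover x) = ⟨z, .mk c'⟩ := by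
  obtain rfl : y = z := by simpa using h 1
  obtain rfl : c = c' := Path.ext (funext h)
  rfl

/-- The class of the constant path. -/
def base (p : X) : PathCover p := ⟨p, .refl p⟩

/-- Append a geodesic to a class of paths. -/
noncomputable def snoc (a : PathCover p) (z : X) : PathCover p :=
  ⟨z, a.cls.trans (.mk (hgeo.path a.endpoint z))⟩

theorem snoc_self {a : PathCover p} (h : a.endpoint = z) : a.snoc hgeo z = a := by
  subst h
  obtain ⟨y, q⟩ := a
  show (⟨y, q.trans (.mk (hgeo.path y y))⟩ : PathCover p) = _
  rw [hgeo.path_self]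
  exact mk_eq_mk_iff.2 (Path.Homotopic.Quotient.trans_refl q)

/-- The detour through `z` and the direct geodesic both stay in the `r`-ball around the endpoint of
`a`. All homotopies of polygons are composed of this move. -/
theorem snoc_snoc (hr : LoopsNullInBalls X r) {a : PathCover p} {z w : X}
    (h : dist a.endpoint z + dist z w < r) :
    (a.snoc hgeo z).snoc hgeo w = a.snoc hgeo w := by
  have h1 := dist_nonneg (x := z) (y := w)
  have h2 := dist_triangle a.endpoint z w
  have h0 := dist_self a.endpoint
  have h3 : ((hgeo.path a.endpoint z).trans (hgeo.path z w)).Homotopic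
      (hgeo.path a.endpoint w) := by
    refine hr.homotopic (z := a.endpoint) (range_trans_subset ?_ ?_) ?_ <;>
    · apply hgeo.range_path_subset
      linarith
  rw [← Path.Homotopic.Quotient.eq, Path.Homotopic.Quotient.mk_trans] at h3
  simp only [snoc, Path.Homotopic.Quotient.trans_assoc, h3]

/-- Append successively geodesics to the points of a list. -/
noncomputable def trace (a : PathCover p) (l : List X) : PathCover p :=
  l.foldl (snoc hgeo) a

@[simp]
theorem trace_nil (a : PathCover p) : a.trace hgeo [] = a := rfl

@[simp]
theorem trace_cons (a : PathCover p) (z : X) (l : List X) :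
    a.trace hgeo (z :: l) = (a.snoc hgeo z).trace hgeo l := rfl

theorem trace_append (a : PathCover p) (l l' : List X) :
    a.trace hgeo (l ++ l') = (a.trace hgeo l).trace hgeo l' := List.foldl_append

theorem endpoint_trace (a : PathCover p) (l : List X) :
    (a.trace hgeo l).endpoint = (a.endpoint :: l).getLast (List.cons_ne_nil _ _) := by
  induction l generalizing a with
  | nil => rfl
  | cons b l ih => rw [trace_cons, ih, List.getLast_cons_cons]; rfl

theorem rel_endpoint_trace {R : X → X → Prop} {a : PathCover p} {l l' : List X} {q : X}
    (h : (a.endpoint :: (l ++ q :: l')).IsChain R) : R (a.trace hgeo l).endpoint q := by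
  induction l generalizing a with
  | nil => exact (List.isChain_cons_cons.1 h).1
  | cons b l ih => exact ih (a := a.snoc hgeo b) (List.isChain_cons_cons.1 h).2

/-- Append successively geodesics to the points `f 1, …, f n`. -/
noncomputable def walk (a : PathCover p) (f : ℕ → X) (n : ℕ) : PathCover p :=
  a.trace hgeo ((List.range n).map fun i => f (i + 1))

theorem walk_succ (a : PathCover p) (f : ℕ → X) (n : ℕ) :
    a.walk hgeo f (n + 1) = (a.walk hgeo f n).snoc hgeo (f (n + 1)) := by
  simp [walk, List.range_succ, trace_append]

theorem endpoint_walk {a : PathCover p} {f : ℕ → X} (h : a.endpoint = f 0) (n : ℕ) :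
    (a.walk hgeo f n).endpoint = f n := by
  cases n with
  | zero => exact h
  | succ n => rw [walk_succ]; rfl

/-- Precompose with a class of paths. -/
noncomputable def translate (a : PathCover p) (b : PathCover a.endpoint) : PathCover p :=
  ⟨b.endpoint, a.cls.trans b.cls⟩

theorem translate_base (a : PathCover p) : a.translate (base a.endpoint) = a := by
  simp [translate, base]

theorem translate_snoc (a : PathCover p) (b : PathCover a.endpoint) (z : X) :
    (a.translate b).snoc hgeo z = a.translate (b.snoc hgeo z) := by
  simp [translate, snoc, Path.Homotopic.Quotient.trans_assoc]

theorem translate_trace (a : PathCover p) (b : PathCover a.endpoint) (l : List X) :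
    (a.translate b).trace hgeo l = a.translate (b.trace hgeo l) := by
  induction l generalizing b with
  | nil => rfl
  | cons z l ih => rw [trace_cons, trace_cons, translate_snoc, ih]

theorem walk_eq_translate (a : PathCover p) (f : ℕ → X) (n : ℕ) :
    a.walk hgeo f n = a.translate ((base a.endpoint).walk hgeo f n) := by
  rw [walk, walk, ← translate_trace, translate_base]

/-- Polygons that are close to each other are homotopic. -/
theorem walk_snoc_eq (hr : LoopsNullInBalls X r) {η : ℝ} (hη : 2 * η ≤ r) {a : PathCover p}
    {f g : ℕ → X} (ha : a.endpoint = f 0) {n : ℕ} (hfg : ∀ i ≤ n, dist (f i) (g i) < η)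
    (hf : ∀ i < n, dist (f i) (f (i + 1)) < η) (hg : ∀ i < n, dist (g i) (g (i + 1)) < η) :
    (a.walk hgeo f n).snoc hgeo (g n) = (a.snoc hgeo (g 0)).walk hgeo g n := by
  induction n with
  | zero => rfl
  | succ n ih =>
    -- Both ways around the quadrilateral `f n, f (n + 1), g (n + 1), g n` collapse to its diagonal
    -- from `f n` to `g (n + 1)`; two sides have total length below `2 * η ≤ r`.
    rw [walk_succ, walk_succ, ← ih (fun i hi => hfg i (by omega)) (fun i hi => hf i (by omega))
      fun i hi => hg i (by omega), snoc_snoc hgeo hr, snoc_snoc hgeo hr]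
    · rw [endpoint_walk hgeo ha]
      linarith [hfg n (by omega), hg n (by omega)]
    · rw [endpoint_walk hgeo ha]
      linarith [hf n (by omega), hfg (n + 1) le_rfl]

/-- A sufficiently fine subdivision of a path gives a polygon in the homotopy class of the path. -/
theorem walk_eq_mk (hr : LoopsNullInBalls X r) (c : Path x y) {t : ℕ → I} {n : ℕ} (ht0 : t 0 = 0)
    (htn : t n = 1) (hle : ∀ i < n, t i ≤ t (i + 1))
    (hball : ∀ i < n, ∀ s ∈ Set.Icc (t i) (t (i + 1)), dist (c (t i)) (c s) < r) :
    (base x).walk hgeo (fun i => c (t i)) n = ⟨y, .mk c⟩ := by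
  -- The first `i` sides represent the initial piece of `c` up to `t i`: each side and the
  -- corresponding piece of `c` lie in one `r`-ball around `c (t i)`. The cast only replaces `c 0`
  -- by `x`.
  have key : ∀ i ≤ n, (base x).walk hgeo (fun i => c (t i)) i =
      ⟨c (t i), .mk ((c.subpath 0 (t i)).cast c.source.symm rfl)⟩ := by
    intro i
    induction i with
    | zero =>
      intro _
      refine mk_eq_mk_of_apply_eq (c := Path.refl x) fun s => ?_
      rw [Path.cast_coe, ht0, Path.subpath_self]
      simp
    | succ i ih =>
      intro hi
      rw [walk_succ, ih (by omega)]
      have h1 : (hgeo.path (c (t i)) (c (t (i + 1)))).Homotopic (c.subpath (t i) (t (i + 1))) := by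
        refine hr.homotopic (z := c (t i)) ?_ ?_
        · apply hgeo.range_path_subset
          rw [dist_self, zero_add]
          exact hball i hi _ ⟨hle i hi, le_rfl⟩
        · rw [Path.range_subpath_of_le _ _ _ (hle i hi)]
          rintro _ ⟨s, hs, rfl⟩
          rw [Metric.mem_ball, dist_comm]
          exact hball i hi s hs
      have h2 : (((c.subpath 0 (t i)).cast c.source.symm rfl).trans
          (hgeo.path (c (t i)) (c (t (i + 1))))).Homotopic
          ((c.subpath 0 (t (i + 1))).cast c.source.symm rfl) := by
        refine ((Path.Homotopic.refl _).hcomp h1).trans ?_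
        exact ⟨Path.Homotopy.subpathTransSubpath c 0 (t i) (t (i + 1))⟩
      rw [← Path.Homotopic.Quotient.eq, Path.Homotopic.Quotient.mk_trans] at h2
      rw [← h2]
      rfl
  rw [key n le_rfl]
  refine mk_eq_mk_of_apply_eq fun s => ?_
  rw [Path.cast_coe, htn, Path.subpath_zero_one, Path.cast_coe]

theorem listLength_nonneg (l : List X) : 0 ≤ listLength l := by
  induction l with
  | nil => exact le_rfl
  | cons a l ih =>
    cases l with
    | nil => exact le_rfl
    | cons b l => exact add_nonneg dist_nonneg ih

/-- Every polygon is represented by a path that is not longer. -/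
theorem exists_path_trace (l : List X) (a : PathCover p) (c : Path p a.endpoint)
    (hc : Path.Homotopic.Quotient.mk c = a.cls) :
    ∃ c' : Path p (a.trace hgeo l).endpoint,
      Path.Homotopic.Quotient.mk c' = (a.trace hgeo l).cls ∧
      pathLength c' ≤ pathLength c + ENNReal.ofReal (listLength (a.endpoint :: l)) := by
  induction l generalizing a with
  | nil => exact ⟨c, hc, le_self_add⟩
  | cons b l ih =>
    let d : Path p b := c.trans (hgeo.path a.endpoint b)
    have hd : Path.Homotopic.Quotient.mk d = (a.snoc hgeo b).cls := by
      show (Path.Homotopic.Quotient.mk c).trans (.mk (hgeo.path a.endpoint b)) = _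
      rw [hc]
      rfl
    have hl : pathLength d ≤ pathLength c + ENNReal.ofReal (dist a.endpoint b) := by
      rw [pathLength_trans]
      gcongr
      exact hgeo.pathLength_path_le _ _
    obtain ⟨c', h1, h2⟩ := ih (a.snoc hgeo b) d hd
    refine ⟨c', h1, h2.trans ?_⟩
    rw [listLength, ENNReal.ofReal_add dist_nonneg (listLength_nonneg _), ← add_assoc]
    exact add_le_add_left hl _

variable {ε : ℝ}

/-- Homotopic chains with small steps give homotopic polygons. -/
theorem trace_eq_of_homotopic (hr : LoopsNullInBalls X r) (hε : 2 * ε ≤ r) {α β : EpsChain ε x y}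
    (h : α.Homotopic β) : (base x).trace hgeo α.tail = (base x).trace hgeo β.tail := by
  have key : ∀ α β : EpsChain ε x y, InsertPoint α.points β.points →
      (base x).trace hgeo α.tail = (base x).trace hgeo β.tail := by
    rintro α β ⟨l₁, l₂, p, h1, h2⟩
    cases l₁ with
    | nil =>
      -- A point inserted in front must be the fixed starting point `x`, so the new side is
      -- constant.
      obtain ⟨rfl, h3⟩ := List.cons.inj h2
      obtain rfl : _ = l₂ := h1
      have h4 : β.tail = x :: α.tail := h3
      rw [h4, trace_cons, snoc_self hgeo (z := x) (a := base x) rfl]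
    | cons b m =>
      obtain ⟨rfl, h3⟩ := List.cons.inj h1
      replace h3 : α.tail = m ++ l₂ := h3
      have h4 : β.tail = m ++ p :: l₂ := (List.cons.inj h2).2
      have hα := α.isChain
      have hβ := β.isChain
      have hβy := β.getLast_eq
      have hαy := α.getLast_eq
      simp only [h3, h4] at hα hβ hαy hβy ⊢
      have hp := rel_endpoint_trace hgeo (a := base x) hβ
      rw [trace_append, trace_append, trace_cons]
      cases l₂ with
      | nil =>
        -- A point inserted at the end must be the fixed endpoint `y`, which the shorter chain has
        -- already reached.
        have hpy : p = y := by simpa using hβy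
        simp only [List.append_nil] at hαy ⊢
        have he : ((base x).trace hgeo m).endpoint = p := by
          rw [endpoint_trace, hpy]
          exact hαy
        rw [snoc_self hgeo he]
      | cons q l =>
        have hpq : dist p q < ε := by
          rw [← List.cons_append, List.isChain_append] at hβ
          exact (List.isChain_cons_cons.1 hβ.2.1).1
        rw [trace_cons, trace_cons, snoc_snoc hgeo hr (by linarith)]
  induction h with
  | refl => rfl
  | tail _ h ih => exact ih.trans (h.elim (key _ _) fun h => (key _ _ h).symm)

/-- Every chain is represented by a path that is not longer. -/
theorem exists_path_trace_tail (α : EpsChain ε x y) : ∃ c : Path x y,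
    (base x).trace hgeo α.tail = ⟨y, .mk c⟩ ∧ pathLength c ≤ ENNReal.ofReal α.length := by
  obtain ⟨c, h1, h2⟩ := exists_path_trace hgeo α.tail (base x) (Path.refl x) rfl
  have hy := (endpoint_trace hgeo (base x) α.tail).trans α.getLast_eq
  have h0 : pathLength (Path.refl x) = 0 := (eVariationOn.eq_zero_iff _).2 (by simp)
  replace h2 : pathLength c ≤ ENNReal.ofReal α.length := by
    refine h2.trans_eq ?_
    erw [h0, zero_add]
    rfl
  revert c
  -- The endpoint of the polygon is `y` only propositionally; generalizing the bundled pair allows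
  -- substitution.
  generalize (base x).trace hgeo α.tail = w at hy
  obtain ⟨e, q⟩ := w
  obtain rfl : e = y := hy
  intro c h1 h2
  exact ⟨c, mk_eq_mk_iff.2 h1.symm, h2⟩

/-- The polygon of a subdivision chain. -/
theorem trace_of_isSubdivisionChain (hr : LoopsNullInBalls X r) (hε : ε ≤ r) {c : Path x y}
    {α : EpsChain ε x y} (hα : IsSubdivisionChain c α) :
    (base x).trace hgeo α.tail = ⟨y, .mk c⟩ := by
  obtain ⟨n, t, ht0, htn, hlt, hball, hpts⟩ := hα
  rw [← walk_eq_mk hgeo hr c ht0 htn (fun i hi => (hlt i hi).le) fun i hi s hs => by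
    have := hball i hi s hs
    rw [Metric.mem_ball, dist_comm] at this
    linarith]
  rw [walk]
  congr 1
  rw [List.range_succ_eq_map, List.map_cons, List.map_map] at hpts
  exact (List.cons.inj hpts).2

end

end PathCover

/-! ### The map `Λ` and concatenation -/

/-- The point `t / 2` of the unit interval. -/
noncomputable def halfLeft (t : I) : I :=
  ⟨t / 2, by have := t.2.1; linarith, by have := t.2.2; linarith⟩

/-- The point `(1 + t) / 2` of the unit interval. -/
noncomputable def halfRight (t : I) : I :=
  ⟨(1 + t) / 2, by have := t.2.1; linarith, by have := t.2.2; linarith⟩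

theorem trans_halfLeft {X : Type*} [TopologicalSpace X] {x y z : X} (c : Path x y) (d : Path y z)
    (t : I) : c.trans d (halfLeft t) = c t := by
  have h2 : (t : ℝ) ≤ 1 := t.2.2
  rw [Path.trans_apply, dif_pos (by simp only [halfLeft]; linarith)]
  congr 1
  ext
  simp only [halfLeft]
  ring

theorem trans_halfRight {X : Type*} [TopologicalSpace X] {x y z : X} (c : Path x y) (d : Path y z)
    (t : I) : c.trans d (halfRight t) = d t := by
  -- Reversal exchanges the two halves, which avoids a case distinction at the midpoint.
  have h : halfRight t = σ (halfLeft (σ t)) := by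
    ext
    simp only [halfRight, halfLeft, unitInterval.coe_symm_eq]
    ring
  have h1 := trans_halfLeft d.symm c.symm (σ t)
  rw [← Path.trans_symm, Path.symm_apply, Path.symm_apply] at h1
  simp only [Function.comp_apply, unitInterval.symm_symm] at h1
  rw [h, h1]

namespace EpsCover

variable {X : Type*} [MetricSpace X] {ε : ℝ} {x y : X}

theorem ofSeq_congr {f g : ℕ → X} {n : ℕ} (h : ∀ i ≤ n, f i = g i) :
    ofSeq ε x f n = ofSeq ε x g n := by
  induction n with
  | zero => rfl
  | succ n ih => rw [ofSeq, ofSeq, ih fun i hi => h i (by omega), h (n + 1) le_rfl]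

/-- Precompose with a class of chains. -/
def translate (a : ChainClass ε x y) (b : EpsCover ε y) : EpsCover ε x :=
  ⟨b.endpoint, a.concat b.cls⟩

theorem translate_snoc (a : ChainClass ε x y) (b : EpsCover ε y) (z : X) :
    (translate a b).snoc z = translate a (b.snoc z) := by
  by_cases h : dist b.endpoint z < ε
  · rw [snoc_eq h, snoc_eq (a := translate a b) h]
    simp [translate, ChainClass.concat_assoc]
  · rw [snoc, snoc, dif_neg h]
    exact dif_neg h

theorem translate_ofSeq (a : ChainClass ε x y) (f g : ℕ → X) (m n : ℕ)
    (hf : ofSeq ε x f m = ⟨y, a⟩) (hfg : ∀ j ≤ n, f (m + j) = g j) :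
    ofSeq ε x f (m + n) = translate a (ofSeq ε y g n) := by
  induction n with
  | zero =>
    rw [add_zero, hf, ofSeq, translate]
    rw [ChainClass.concat_one]
  | succ n ih =>
    rw [← add_assoc, ofSeq, ofSeq, ih fun j hj => hfg j (by omega), translate_snoc, add_assoc,
      hfg _ le_rfl]

theorem mk_eq_mk_iff {a b : ChainClass ε x y} :
    (⟨y, a⟩ : EpsCover ε x) = ⟨y, b⟩ ↔ a = b :=
  ⟨fun h => eq_of_heq (EpsCover.mk.inj h).2, fun h => h ▸ rfl⟩

end EpsCover

section ChainMap

variable {X : Type*} [MetricSpace X] {ε δ r : ℝ} {x y z : X}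

/-- Expresses `Λ` by an explicit uniform grid, so that grids of different paths can be matched point
by point. -/
theorem chainMap_eq_ofSeq (hε : 0 < ε) (c : Path x y) {M : ℕ} (hM : 0 < M)
    (h : ∀ s t : I, dist s t ≤ 1 / (M : ℝ) → dist (c s) (c t) < ε) :
    (⟨y, chainMap hε (.mk c)⟩ : EpsCover ε x) =
      EpsCover.ofSeq ε x (fun i => c (unitFrac M i)) M := by
  obtain ⟨α, hα⟩ := exists_isSubdivisionChain hε c
  rw [chainMap_mk hε c α hα]
  exact mk_eq_ofSeq c hα hε hM h

theorem chainMap_trans (hε : 0 < ε) (q : Path.Homotopic.Quotient x y)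
    (q' : Path.Homotopic.Quotient y z) :
    chainMap hε (q.trans q') = (chainMap hε q).concat (chainMap hε q') := by
  induction q using Path.Homotopic.Quotient.ind with | mk c
  induction q' using Path.Homotopic.Quotient.ind with | mk d
  rw [← Path.Homotopic.Quotient.mk_trans]
  obtain ⟨M, hM, h⟩ := exists_fine_modulus hε (c.trans d) (c.trans d).continuous
  have hM' : (0 : ℝ) < M := by exact_mod_cast hM
  have h1 : ∀ s t : I, dist s t ≤ 1 / (M : ℝ) → dist (c s) (c t) < ε := by
    intro s t hst
    rw [← trans_halfLeft c d, ← trans_halfLeft c d]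
    apply h
    refine le_trans ?_ hst
    rw [Subtype.dist_eq, Subtype.dist_eq, Real.dist_eq, Real.dist_eq]
    simp only [halfLeft]
    rw [← sub_div, abs_div, abs_two]
    linarith [abs_nonneg ((s : ℝ) - t)]
  have h2 : ∀ s t : I, dist s t ≤ 1 / (M : ℝ) → dist (d s) (d t) < ε := by
    intro s t hst
    rw [← trans_halfRight c d, ← trans_halfRight c d]
    apply h
    refine le_trans ?_ hst
    rw [Subtype.dist_eq, Subtype.dist_eq, Real.dist_eq, Real.dist_eq]
    simp only [halfRight]
    rw [← sub_div, abs_div, abs_two, add_sub_add_left_eq_sub]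
    linarith [abs_nonneg ((s : ℝ) - t)]
  -- The grid with `2 * M` steps on the concatenation consists exactly of the grids with `M` steps
  -- on `c` and on `d`.
  have h3 : ∀ s t : I, dist s t ≤ 1 / ((M + M : ℕ) : ℝ) →
      dist (c.trans d s) (c.trans d t) < ε := by
    intro s t hst
    refine h s t (hst.trans ?_)
    apply one_div_le_one_div_of_le hM'
    push_cast
    linarith
  have e1 := chainMap_eq_ofSeq hε c hM h1
  have e2 := chainMap_eq_ofSeq hε d hM h2
  have e3 := chainMap_eq_ofSeq hε (c.trans d) (by omega) h3
  have hL : ∀ i ≤ M, c.trans d (unitFrac (M + M) i) = c (unitFrac M i) := by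
    intro i hi
    rw [← trans_halfLeft c d]
    congr 1
    ext
    simp only [halfLeft]
    rw [coe_unitFrac hM hi, coe_unitFrac (by omega) (by omega)]
    push_cast
    field_simp
    ring
  have hR : ∀ j ≤ M, c.trans d (unitFrac (M + M) (M + j)) = d (unitFrac M j) := by
    intro j hj
    rw [← trans_halfRight c d]
    congr 1
    ext
    simp only [halfRight]
    rw [coe_unitFrac hM hj, coe_unitFrac (by omega) (by omega)]
    push_cast
    field_simp
    ring
  rw [← EpsCover.ofSeq_congr hL] at e1
  rw [EpsCover.translate_ofSeq _ _ (fun i => d (unitFrac M i)) M M e1.symm hR, ← e2] at e3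
  exact EpsCover.mk_eq_mk_iff.1 e3

theorem chainMap_path (hgeo : IsGeodesicSpace X) (hε : 0 < ε) (h : dist x y < ε) :
    chainMap hε (.mk (hgeo.path x y)) = .mk (EpsChain.pair h) := by
  -- No interior point is needed, since a geodesic of length below `ε` stays in the `ε`-ball around
  -- its start.
  refine chainMap_mk hε _ _ ⟨1, fun i => if i = 0 then 0 else 1, rfl, rfl, ?_, ?_, ?_⟩
  · intro i hi
    obtain rfl : i = 0 := by omega
    simp
  · intro i hi s _
    obtain rfl : i = 0 := by omega
    simp only [if_true, Path.source, Metric.mem_ball]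
    rw [dist_comm]
    exact (hgeo.dist_source_path x y s).trans_lt h
  · simp [EpsChain.points, EpsChain.pair, List.range_succ]

/-- By `chainMap_trans` the image is idempotent, and an idempotent of a group is trivial. -/
theorem chainMap_refl (hε : 0 < ε) (x : X) : chainMap hε (.refl x) = ChainClass.one ε x := by
  have h := chainMap_trans hε (.refl x) (.refl x)
  rw [Path.Homotopic.Quotient.refl_trans] at h
  have h2 := congrArg (ChainClass.concat (chainMap hε (.refl x)).reverse) h
  rw [← ChainClass.concat_assoc, ChainClass.reverse_concat_self, ChainClass.one_concat] at h2
  exact h2.symm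

/-- Forgetting a polygon of geodesics except for its vertices recovers the chain of vertices. -/
theorem chainMap_trace (hgeo : IsGeodesicSpace X) (hε : 0 < ε) {p : X} (γ : EpsChain ε x y)
    (q : Path.Homotopic.Quotient p x) {q' : Path.Homotopic.Quotient p y}
    (h : (⟨x, q⟩ : PathCover p).trace hgeo γ.tail = ⟨y, q'⟩) :
    chainMap hε q' = (chainMap hε q).concat (.mk γ) := by
  -- The induction moves the first side from the chain into the prefix `q`, so the start of the
  -- chain and the prefix must vary.
  suffices H : ∀ (l : List X) (x : X) (γ : EpsChain ε x y) (q : Path.Homotopic.Quotient p x),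
      γ.tail = l → (⟨x, q⟩ : PathCover p).trace hgeo γ.tail = ⟨y, q'⟩ →
      chainMap hε q' = (chainMap hε q).concat (.mk γ) from H _ x γ q rfl h
  intro l
  induction l with
  | nil =>
    intro x γ q h h'
    have h2 := γ.getLast_eq
    simp only [h, List.getLast_singleton] at h2
    subst h2
    rw [h, PathCover.trace_nil] at h'
    rw [EpsChain.eq_single_of_tail_nil γ h, ← PathCover.mk_eq_mk_iff.1 h']
    exact (ChainClass.concat_one _).symm
  | cons b l ih =>
    intro x γ q h h'
    obtain ⟨hb, β, hβ, rfl⟩ := EpsChain.eq_pair_concat γ h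
    have h3 : ((EpsChain.pair hb).concat β).tail = b :: β.tail := rfl
    rw [h3, PathCover.trace_cons] at h'
    rw [ih b β (q.trans (.mk (hgeo.path x b))) hβ h', chainMap_trans, chainMap_path hgeo hε hb,
      ChainClass.concat_assoc]
    rfl

theorem chainMap_of_trace_base (hgeo : IsGeodesicSpace X) (hε : 0 < ε) (γ : EpsChain ε x y)
    {q : Path.Homotopic.Quotient x y}
    (h : (PathCover.base x).trace hgeo γ.tail = ⟨y, q⟩) : chainMap hε q = .mk γ := by
  rw [chainMap_trace hgeo hε γ (.refl x) h, chainMap_refl, ChainClass.one_concat]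

/-- The polygon through the points of a chain is a preimage; no smallness of `ε` is involved. -/
theorem chainMap_surjective (hgeo : IsGeodesicSpace X) (hε : 0 < ε) (x y : X) :
    Function.Surjective (chainMap hε : Path.Homotopic.Quotient x y → ChainClass ε x y) := by
  intro a
  obtain ⟨α, rfl⟩ := ChainClass.mk_surjective a
  obtain ⟨c, hc, -⟩ := PathCover.exists_path_trace_tail hgeo α
  exact ⟨_, chainMap_of_trace_base hgeo hε α hc⟩

end ChainMap

/-! ### Homotopies of chains at different scales -/

namespace EpsChain

variable {X : Type*} [MetricSpace X] {ε δ r : ℝ} {x y z : X}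

theorem Homotopic.ofLE {α β : EpsChain ε x y} (h : α.Homotopic β) (hε : ε ≤ δ) :
    (α.ofLE hε).Homotopic (β.ofLE hε) := by
  induction h with
  | refl => exact .refl _
  | tail _ h ih => exact .tail ih h

/-- Finitely many strict inequalities leave room. The bound `δ ≤ δ'` keeps the new scale above the
scales already in use. -/
theorem exists_lt_isChain {l : List X} (h : l.IsChain fun a b => dist a b < ε) (hδ : δ < ε) :
    ∃ δ', δ ≤ δ' ∧ δ' < ε ∧ l.IsChain fun a b => dist a b < δ' := by
  induction l with
  | nil => exact ⟨δ, le_rfl, hδ, .nil⟩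
  | cons a l ih =>
    cases l with
    | nil => exact ⟨δ, le_rfl, hδ, .singleton _⟩
    | cons b l =>
      rw [List.isChain_cons_cons] at h
      obtain ⟨δ', h1, h2, h3⟩ := ih h.2
      obtain ⟨η, h4, h5⟩ := exists_between h.1
      refine ⟨max δ' η, h1.trans (le_max_left _ _), max_lt h2 h5, List.isChain_cons_cons.2
        ⟨h4.trans_le (le_max_right _ _), h3.imp fun _ _ h => h.trans_le (le_max_left _ _)⟩⟩

/-- Homotopies of `ε`-chains take place at a slightly smaller scale. -/
theorem Homotopic.exists_lt {α : EpsChain δ x y} (hδ : δ < ε) {β : EpsChain ε x y}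
    (h : (α.ofLE hδ.le).Homotopic β) : ∃ (δ' : ℝ) (h' : δ ≤ δ'), δ' < ε ∧
      ∃ β' : EpsChain δ' x y, β'.tail = β.tail ∧ (α.ofLE h').Homotopic β' := by
  induction h with
  | refl => exact ⟨δ, le_rfl, hδ, α, rfl, .refl _⟩
  | @tail β γ _ h ih =>
    obtain ⟨δ₁, h1, h2, β', h3, h4⟩ := ih
    -- The new chain may need a larger scale than the preceding ones, but still below `ε`; the
    -- earlier homotopy is carried up to it.
    obtain ⟨δ₂, h5, h6, h7⟩ := exists_lt_isChain γ.isChain h2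
    refine ⟨δ₂, h1.trans h5, h6, ⟨γ.tail, h7, γ.getLast_eq⟩, rfl, .tail (h4.ofLE h5) ?_⟩
    have h8 : (β'.ofLE h5).points = β.points := by
      show x :: β'.tail = x :: β.tail
      rw [h3]
    rw [BasicMove, h8]
    exact h

/-- Being null passes to larger scales and, by `Homotopic.exists_lt`, to slightly smaller ones.
Hence, if `α` were not `δ`-null, the supremum of the scales at which it is not null would itself be
such a scale, would lie below `ε`, and would be critical. -/
theorem isNull_of_lowerBounds (hε : ε ∈ lowerBounds (homotopyCriticalSpectrum X)) (hδ : 0 < δ)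
    (h : δ ≤ ε) {α : EpsChain δ x x} (hα : (α.ofLE h).IsNull) : α.IsNull := by
  by_contra hcon
  have hmono : ∀ (s t : ℝ) (hs : δ ≤ s) (ht : s ≤ t), (α.ofLE hs).IsNull →
      (α.ofLE (hs.trans ht)).IsNull := fun s t hs ht h => Homotopic.ofLE h ht
  have hopen : ∀ (s : ℝ) (hs : δ < s), (α.ofLE hs.le).IsNull →
      ∃ (t : ℝ) (ht : δ ≤ t), t < s ∧ (α.ofLE ht).IsNull := by
    intro s hs hn
    obtain ⟨t, ht, hts, β, h1, h2⟩ := Homotopic.exists_lt hs hn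
    refine ⟨t, ht, hts, ?_⟩
    rwa [eq_single_of_tail_nil β h1] at h2
  set S : Set ℝ := {s | ∃ hs : δ ≤ s, ¬ (α.ofLE hs).IsNull} with hS
  have hub : ∀ (t : ℝ) (ht : δ ≤ t), (α.ofLE ht).IsNull → t ∈ upperBounds S := by
    rintro t ht hn s ⟨hs, hs'⟩
    by_contra! hts
    exact hs' (hmono t s ht hts.le hn)
  have hδS : δ ∈ S := ⟨le_rfl, hcon⟩
  have hbdd : BddAbove S := ⟨ε, hub ε h hα⟩
  have hδσ : δ ≤ sSup S := le_csSup hbdd hδS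
  -- If `α` were null at the supremum, it would be null at a smaller scale, which would be a smaller
  -- upper bound. When the supremum is `δ` there is no room below, and the assumption on `δ` applies
  -- directly.
  have hσ : ¬ (α.ofLE hδσ).IsNull := by
    intro hn
    rcases hδσ.eq_or_lt with heq | hlt
    · apply hcon
      have : ∀ (t : ℝ) (ht : δ ≤ t), δ = t → (α.ofLE ht).IsNull → α.IsNull := by
        rintro t ht rfl h
        exact h
      exact this _ _ heq hn
    · obtain ⟨t, ht, hts, hn'⟩ := hopen _ hlt hn
      exact absurd (csSup_le ⟨δ, hδS⟩ (hub t ht hn')) (not_le.2 hts)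
  have hlt : sSup S < ε := by
    have hδε : δ < ε := by
      refine lt_of_le_of_ne h ?_
      rintro rfl
      exact hcon hα
    obtain ⟨t, ht, hts, hn'⟩ := hopen _ hδε hα
    exact (csSup_le ⟨δ, hδS⟩ (hub t ht hn')).trans_lt hts
  have hmem : sSup S ∈ homotopyCriticalSpectrum X := by
    refine ⟨hδ.trans_le hδσ, x, α.ofLE hδσ, hσ, fun s hs => ?_⟩
    by_contra hn
    exact absurd (le_csSup hbdd (show s ∈ S from ⟨hδσ.trans hs.le, hn⟩)) (not_le.2 hs)
  exact absurd (hε hmem) (not_le.2 hlt)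

/-- Reduces to loops by considering `α` followed by the reversal of `β`. -/
theorem homotopic_of_lowerBounds (hε : ε ∈ lowerBounds (homotopyCriticalSpectrum X)) (hδ : 0 < δ)
    (h : δ ≤ ε) {α β : EpsChain δ x y} (hαβ : (α.ofLE h).Homotopic (β.ofLE h)) :
    α.Homotopic β := by
  have h1 : (α.concat β.reverse).IsNull := by
    refine isNull_of_lowerBounds hε hδ h ?_
    exact (hαβ.concat_right (β.ofLE h).reverse).trans (concat_reverse _)
  rw [IsNull, ← ChainClass.mk_eq_mk, ← ChainClass.concat_mk, ← ChainClass.reverse_mk] at h1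
  rw [← ChainClass.mk_eq_mk]
  have h2 := congrArg (fun a => ChainClass.concat a (.mk β)) h1
  simp only [ChainClass.concat_assoc, ChainClass.reverse_concat_self, ChainClass.concat_one] at h2
  exact h2.trans (ChainClass.one_concat _)

end EpsChain

/-! ### Lower bounds of the spectrum, injectivity of `Λ`, and lengths of classes -/

section Spectrum

variable {X : Type*} [MetricSpace X] {ε δ r : ℝ} {x y z : X}

/-- The polygon of a loop depends only on its points, not on the scale. If the loop is `r / 2`-null
its polygon is null-homotopic, and `Λ` at the smaller scale `ε` turns this into `ε`-nullity. -/
theorem mem_lowerBounds_homotopyCriticalSpectrum (hgeo : IsGeodesicSpace X)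
    (hr : LoopsNullInBalls X r) : r / 2 ∈ lowerBounds (homotopyCriticalSpectrum X) := by
  rintro ε ⟨hε, x, α, h1, h2⟩
  by_contra! hlt
  apply h1
  have h3 : (PathCover.base x).trace hgeo α.tail = PathCover.base x :=
    PathCover.trace_eq_of_homotopic hgeo hr (by linarith) (h2 (r / 2) hlt)
  exact ChainClass.mk_eq_mk.1
    ((chainMap_of_trace_base hgeo hε α h3).symm.trans (chainMap_refl hε x))

theorem IsSubdivisionChain.ofLE {c : Path x y} {α : EpsChain δ x y} (hα : IsSubdivisionChain c α)
    (h : δ ≤ ε) : IsSubdivisionChain c (α.ofLE h) := by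
  obtain ⟨n, t, h0, h1, h2, h3, h4⟩ := hα
  exact ⟨n, t, h0, h1, h2, fun i hi s hs => Metric.ball_subset_ball h (h3 i hi s hs), h4⟩

/-- Subdivide both paths at scale `min ε (r / 2)`. A homotopy of these chains at scale `ε` descends
to that scale because `ε` is a lower bound of the spectrum, and there homotopic chains have
homotopic polygons, which represent the two paths. -/
theorem chainMap_injective (hgeo : IsGeodesicSpace X) (hr0 : 0 < r) (hr : LoopsNullInBalls X r)
    (hε : 0 < ε) (hmem : ε ∈ lowerBounds (homotopyCriticalSpectrum X)) (x y : X) :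
    Function.Injective (chainMap hε : Path.Homotopic.Quotient x y → ChainClass ε x y) := by
  intro q q' h
  induction q using Path.Homotopic.Quotient.ind with | mk c
  induction q' using Path.Homotopic.Quotient.ind with | mk d
  have hδ : 0 < min ε (r / 2) := lt_min hε (by linarith)
  have h1 := min_le_left ε (r / 2)
  have h2 := min_le_right ε (r / 2)
  obtain ⟨α, hα⟩ := exists_isSubdivisionChain hδ c
  obtain ⟨β, hβ⟩ := exists_isSubdivisionChain hδ d
  rw [chainMap_mk hε c _ (hα.ofLE h1), chainMap_mk hε d _ (hβ.ofLE h1), ChainClass.mk_eq_mk] at h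
  have h3 := PathCover.trace_eq_of_homotopic hgeo hr (by linarith)
    (EpsChain.homotopic_of_lowerBounds hmem hδ h1 h)
  rw [PathCover.trace_of_isSubdivisionChain hgeo hr (by linarith) hα,
    PathCover.trace_of_isSubdivisionChain hgeo hr (by linarith) hβ] at h3
  exact PathCover.mk_eq_mk_iff.1 h3

theorem listLength_map_range (f : ℕ → X) (n : ℕ) :
    listLength ((List.range (n + 1)).map f) = ∑ i ∈ Finset.range n, dist (f i) (f (i + 1)) := by
  induction n generalizing f with
  | zero => simp [listLength]
  | succ n ih =>
    have h := ih fun i => f (i + 1)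
    rw [List.range_succ_eq_map, List.map_cons, List.map_map] at h ⊢
    rw [List.range_succ_eq_map, List.map_cons, List.map_map]
    rw [listLength, Finset.sum_range_succ', add_comm, ← h]
    rfl

theorem sum_dist_le_pathLength (c : Path x y) {t : ℕ → I} {n : ℕ}
    (ht : ∀ i < n, t i ≤ t (i + 1)) :
    ENNReal.ofReal (∑ i ∈ Finset.range n, dist (c (t i)) (c (t (i + 1)))) ≤ pathLength c := by
  have hmono : MonotoneOn t (Set.Iic n) := by
    intro i _ j hj hij
    induction j, hij using Nat.le_induction with
    | base => exact le_rfl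
    | succ j _ ih => exact (ih (Nat.le_of_succ_le hj)).trans (ht j hj)
  have := eVariationOn.sum_le_of_monotoneOn_Iic (f := c) hmono fun i _ => Set.mem_univ (t i)
  rw [ENNReal.ofReal_sum_of_nonneg fun _ _ => dist_nonneg]
  refine le_trans (Finset.sum_le_sum fun i _ => ?_) this
  rw [edist_comm, edist_dist]

theorem IsSubdivisionChain.length_le {c : Path x y} {α : EpsChain ε x y}
    (hα : IsSubdivisionChain c α) : ENNReal.ofReal α.length ≤ pathLength c := by
  obtain ⟨n, t, h0, h1, h2, h3, h4⟩ := hα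
  rw [EpsChain.length, h4, listLength_map_range]
  exact sum_dist_le_pathLength c fun i hi => (h2 i hi).le

/-- A subdivision chain is no longer than its path. Conversely, a nearly shortest chain has a
polygon that is no longer, and injectivity of `Λ` places this polygon in the given class. -/
theorem pathClassNorm_eq (hgeo : IsGeodesicSpace X) (hr0 : 0 < r) (hr : LoopsNullInBalls X r)
    (hε : 0 < ε) (hmem : ε ∈ lowerBounds (homotopyCriticalSpectrum X))
    (q : Path.Homotopic.Quotient x y) :
    pathClassNorm q = ENNReal.ofReal (chainMap hε q).norm := by
  apply le_antisymm
  · refine ENNReal.le_of_forall_pos_le_add fun η hη _ => ?_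
    obtain ⟨γ, h1, h2⟩ : ∃ γ : EpsChain ε x y, ChainClass.mk γ = chainMap hε q ∧
        γ.length < (chainMap hε q).norm + η := by
      by_contra! hcon
      have := ChainClass.le_norm hcon
      have : (0 : ℝ) < η := hη
      linarith
    obtain ⟨c, h3, h4⟩ := PathCover.exists_path_trace_tail hgeo γ
    have h5 := chainMap_injective hgeo hr0 hr hε hmem x y
      ((chainMap_of_trace_base hgeo hε γ h3).trans h1)
    calc pathClassNorm q ≤ pathLength c := iInf₂_le c h5
      _ ≤ ENNReal.ofReal γ.length := h4
      _ ≤ ENNReal.ofReal ((chainMap hε q).norm + η) := ENNReal.ofReal_le_ofReal h2.le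
      _ ≤ _ := ENNReal.ofReal_add_le.trans (by simp)
  · refine le_iInf₂ fun c hc => ?_
    obtain ⟨α, hα⟩ := exists_isSubdivisionChain hε c
    refine le_trans (ENNReal.ofReal_le_ofReal ?_) hα.length_le
    rw [← hc, chainMap_mk hε c α hα]
    exact ChainClass.norm_le_length α

end Spectrum

/-! ### The covering map `φ_ε` -/

/-- Some representative is shorter than `ε` and collapses to its endpoints. Consequently points of
`X_ε` closer than `ε` differ by a single appended step. -/
theorem ChainClass.eq_mk_pair_of_norm_lt {X : Type*} [MetricSpace X] {ε : ℝ} {x y : X}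
    {a : ChainClass ε x y} (h : a.norm < ε) :
    ∃ h' : dist x y < ε, a = .mk (EpsChain.pair h') := by
  obtain ⟨γ, hγ, hl⟩ : ∃ γ : EpsChain ε x y, mk γ = a ∧ γ.length < ε := by
    by_contra! hcon
    exact absurd (le_norm hcon) (not_le.2 h)
  exact ⟨_, hγ ▸ mk_eq_mk.2 (γ.homotopic_pair hl)⟩

namespace EpsCover

variable {X : Type*} [MetricSpace X] {ε : ℝ} {p : X}

theorem dist_eq (a b : EpsCover ε p) : dist a b = ((a.cls.reverse).concat b.cls).norm := rfl

theorem dist_endpoint_le (a b : EpsCover ε p) : dist a.endpoint b.endpoint ≤ dist a b :=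
  ChainClass.dist_le_norm _

theorem translate_base (a : EpsCover ε p) :
    translate a.cls ⟨a.endpoint, ChainClass.one ε a.endpoint⟩ = a := by
  rw [translate, ChainClass.concat_one]

theorem snoc_endpoint_of_dist_lt {a b : EpsCover ε p} (h : dist a b < ε) :
    a.snoc b.endpoint = b := by
  obtain ⟨h', h1⟩ := ChainClass.eq_mk_pair_of_norm_lt h
  rw [snoc_eq h', ← h1, ← ChainClass.concat_assoc, ChainClass.concat_reverse,
    ChainClass.one_concat]

/-- Gives continuity of the inverse of the trivialization along each sheet. -/
theorem dist_snoc_snoc_le {a : EpsCover ε p} {u v : X} (hu : dist a.endpoint u < ε)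
    (hv : dist a.endpoint v < ε) (huv : dist u v < ε) :
    dist (a.snoc u) (a.snoc v) ≤ dist u v := by
  rw [← snoc_snoc hu huv hv]
  generalize hb : a.snoc u = b
  have hbu : b.endpoint = u := by rw [← hb, snoc_fst hu]
  subst hbu
  rw [snoc_eq huv, dist_eq, ← ChainClass.concat_assoc, ChainClass.reverse_concat_self,
    ChainClass.one_concat]
  refine (ChainClass.norm_le_length _).trans_eq ?_
  simp [EpsChain.length, EpsChain.points, EpsChain.pair, listLength]

end EpsCover

section Covering

variable {X : Type*} [MetricSpace X] {ε r : ℝ} {p : X}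

theorem continuous_endpointMap : Continuous (endpointMap ε p) :=
  (LipschitzWith.of_dist_le_mul (K := 1) fun a b => by
    rw [NNReal.coe_one, one_mul]
    exact EpsCover.dist_endpoint_le a b).continuous

/-- The ball of radius `ε` around `x` is evenly covered for every `ε > 0`: appending `x` to a class
over the ball gives its point in the fibre, and appending the endpoint again recovers the class. -/
theorem isCoveringMap_endpointMap (hε : 0 < ε) : IsCoveringMap (endpointMap ε p) := by
  intro x
  have hfib : ∀ a b : endpointMap ε p ⁻¹' {x}, dist a b < ε → a = b := by
    rintro ⟨a, ha⟩ ⟨b, hb⟩ h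
    ext1
    rw [← EpsCover.snoc_endpoint_of_dist_lt h]
    exact (EpsCover.snoc_self hε (Eq.trans ha hb.symm)).symm
  have hU : ∀ a : EpsCover ε p, a ∈ endpointMap ε p ⁻¹' Metric.ball x ε →
      dist a.endpoint x < ε := fun a ha => ha
  have hU' : ∀ (a : EpsCover ε p) (y : X), a ∈ endpointMap ε p ⁻¹' {x} → y ∈ Metric.ball x ε →
      dist a.endpoint y < ε := by
    intro a y ha hy
    rw [show a.endpoint = x from ha, dist_comm]
    exact hy
  let F : endpointMap ε p ⁻¹' Metric.ball x ε → Metric.ball x ε × (endpointMap ε p ⁻¹' {x}) :=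
    fun b => (⟨b.1.endpoint, b.2⟩, ⟨b.1.snoc x, EpsCover.snoc_fst (hU _ b.2)⟩)
  let G : Metric.ball x ε × (endpointMap ε p ⁻¹' {x}) → endpointMap ε p ⁻¹' Metric.ball x ε :=
    fun ya => ⟨ya.2.1.snoc ya.1.1, by
      obtain ⟨⟨y, hy⟩, a, ha⟩ := ya
      show endpointMap ε p (a.snoc y) ∈ Metric.ball x ε
      rw [endpointMap, EpsCover.snoc_fst (hU' a y ha hy)]
      exact hy⟩
  refine ⟨?_, Metric.ball x ε, Metric.mem_ball_self hε, Metric.isOpen_ball,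
    Metric.isOpen_ball.preimage continuous_endpointMap,
    ⟨⟨F, G, ?_, ?_⟩, ?_, ?_⟩, fun b => rfl⟩
  · exact DiscreteTopology.of_forall_le_dist hε fun a b hab => by
      by_contra! h
      exact hab (hfib a b h)
  · rintro ⟨b, hb⟩
    ext1
    show (b.snoc x).snoc b.endpoint = b
    have h1 : dist x b.endpoint < ε := by rw [dist_comm]; exact hb
    rw [EpsCover.snoc_snoc (hU b hb) h1 (by rwa [dist_self]), EpsCover.snoc_self hε rfl]
  · rintro ⟨⟨y, hy⟩, a, ha⟩
    have h1 : a.endpoint = x := ha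
    have h2 := hU' a y ha hy
    refine Prod.ext (Subtype.ext (EpsCover.snoc_fst h2)) (Subtype.ext ?_)
    show (a.snoc y).snoc x = a
    rw [EpsCover.snoc_snoc h2 hy (by rwa [h1, dist_self]), EpsCover.snoc_self hε h1]
  · refine Continuous.prodMk ((continuous_endpointMap.comp continuous_subtype_val).subtype_mk _) ?_
    -- The fibre component is constant on `ε`-balls, so the same radius works for every `η`.
    refine Metric.continuous_iff.2 fun b η hη => ⟨ε, hε, fun b' h => ?_⟩
    have h1 : b.1.snoc b'.1.endpoint = b'.1 := EpsCover.snoc_endpoint_of_dist_lt (by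
      rw [dist_comm]; exact h)
    have h2 : dist b.1.endpoint b'.1.endpoint < ε :=
      (EpsCover.dist_endpoint_le b.1 b'.1).trans_lt (by rw [dist_comm]; exact h)
    have h3 : b'.1.snoc x = b.1.snoc x := by
      rw [← h1, EpsCover.snoc_snoc h2 (hU _ b'.2) (hU _ b.2)]
    refine lt_of_eq_of_lt ?_ hη
    rw [Subtype.dist_eq]
    show dist (b'.1.snoc x) (b.1.snoc x) = 0
    rw [h3, dist_self]
  · refine Metric.continuous_iff.2 ?_
    rintro ⟨⟨y, hy⟩, a⟩ η hη
    -- The bound `ε` forces equal fibre components, as distinct points of the fibre are at least `ε`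
    -- apart; `η` then controls the distance within the sheet.
    refine ⟨min ε η, lt_min hε hη, ?_⟩
    rintro ⟨⟨y', hy'⟩, a'⟩ h
    rw [Prod.dist_eq, max_lt_iff, lt_min_iff, lt_min_iff] at h
    obtain rfl : a' = a := hfib _ _ h.2.1
    have h1 : dist y' y < ε := h.1.1
    refine (EpsCover.dist_snoc_snoc_le (hU' _ _ a'.2 hy') (hU' _ _ a'.2 hy) h1).trans_lt h.1.2

/-- Paths in `X_ε` are lifts of their images by `Λ`. -/
theorem translate_chainMap (hε : 0 < ε) {a b : EpsCover ε p} (γ : Path a b) :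
    EpsCover.translate a.cls ⟨b.endpoint,
      chainMap hε (.mk (γ.map continuous_endpointMap : Path a.endpoint b.endpoint))⟩ = b := by
  obtain ⟨M, hM, h⟩ := exists_fine_modulus hε γ γ.continuous
  rw [chainMap_eq_ofSeq hε _ hM fun s t hst =>
    (EpsCover.dist_endpoint_le (γ s) (γ t)).trans_lt (h s t hst)]
  -- Successive grid values of `γ` are closer than `ε`, so each arises from the previous one by
  -- appending its endpoint.
  have key : ∀ i ≤ M, EpsCover.translate a.cls (EpsCover.ofSeq ε a.endpoint
      (fun i => (γ (unitFrac M i)).endpoint) i) = γ (unitFrac M i) := by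
    intro i
    induction i with
    | zero =>
      intro _
      rw [unitFrac_zero hM, γ.source]
      exact EpsCover.translate_base a
    | succ i ih =>
      intro hi
      rw [EpsCover.ofSeq, ← EpsCover.translate_snoc, ih (by omega),
        EpsCover.snoc_endpoint_of_dist_lt]
      apply h
      rw [Subtype.dist_eq, Real.dist_eq, coe_unitFrac_succ hM hi, sub_add_cancel_left, abs_neg,
        abs_of_nonneg (by positivity)]
  refine (key M le_rfl).trans ?_
  rw [unitFrac_self hM, γ.target]

/-- A class `Λ([c])` is the endpoint of the lift of `c` from the base class, which gives
connectedness. Two paths in `X_ε` with common endpoints have images with equal `Λ`, hence homotopic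
images, and a covering map is injective on homotopy classes of paths. -/
theorem isUniversalCoveringMap_endpointMap (hgeo : IsGeodesicSpace X) (hr0 : 0 < r)
    (hr : LoopsNullInBalls X r) (hε : 0 < ε)
    (hmem : ε ∈ lowerBounds (homotopyCriticalSpectrum X)) (p : X) :
    IsUniversalCoveringMap (endpointMap ε p) := by
  have hcov := isCoveringMap_endpointMap (p := p) hε
  refine ⟨hcov, fun y => ⟨⟨y, chainMap hε (.mk (hgeo.path p y))⟩, rfl⟩, ?_⟩
  rw [simply_connected_iff_paths_homotopic']
  constructor
  · refine pathConnectedSpace_iff_univ.2 ⟨⟨p, ChainClass.one ε p⟩, Set.mem_univ _, ?_⟩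
    rintro ⟨y, A⟩ _
    rw [joinedIn_univ]
    obtain ⟨q, rfl⟩ := chainMap_surjective hgeo hε p y A
    induction q using Path.Homotopic.Quotient.ind with | mk c
    have h0 : c 0 = endpointMap ε p ⟨p, ChainClass.one ε p⟩ := c.source
    let Γ := hcov.liftPath c ⟨p, ChainClass.one ε p⟩ h0
    have hΓ : ∀ t, (Γ t).endpoint = c t := fun t => congrFun (hcov.liftPath_lifts c _ h0) t
    let γ : Path (⟨p, ChainClass.one ε p⟩ : EpsCover ε p) (Γ 1) :=
      ⟨Γ, hcov.liftPath_zero c _ h0, rfl⟩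
    have h1 := translate_chainMap hε γ
    have h2 : Γ 1 = ⟨y, chainMap hε (.mk c)⟩ := by
      rw [← h1, EpsCover.translate, ChainClass.one_concat]
      have aux : ∀ (z : X) (d : Path p z), z = y → (∀ t, d t = c t) →
          (⟨z, chainMap hε (.mk d)⟩ : EpsCover ε p) = ⟨y, chainMap hε (.mk c)⟩ := by
        rintro z d rfl h
        rw [show d = c from Path.ext (funext h)]
      exact aux _ _ ((hΓ 1).trans c.target) hΓ
    exact ⟨γ.cast rfl h2.symm⟩
  · intro a b γ γ'
    have h1 := (translate_chainMap hε γ).trans (translate_chainMap hε γ').symm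
    have h2 := EpsCover.mk_eq_mk_iff.1 h1
    have h3 := congrArg (ChainClass.concat a.cls.reverse) h2
    rw [← ChainClass.concat_assoc, ← ChainClass.concat_assoc, ChainClass.reverse_concat_self] at h3
    simp only [ChainClass.one_concat] at h3
    have h4 := chainMap_injective hgeo hr0 hr hε hmem _ _ h3
    rw [← Path.Homotopic.Quotient.eq]
    exact hcov.injective_path_homotopic_map a b h4

end Covering

/-- `Λ` as an isomorphism of groups. -/
theorem exists_mulEquiv_chainMap {X : Type*} [MetricSpace X] {ε r : ℝ} (hgeo : IsGeodesicSpace X)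
    (hr0 : 0 < r) (hr : LoopsNullInBalls X r) (hε : 0 < ε)
    (hmem : ε ∈ lowerBounds (homotopyCriticalSpectrum X)) (p : X) :
    ∃ Φ : (FundamentalGroup X p)ᵐᵒᵖ ≃* EpsGroup ε p,
      ∀ g : FundamentalGroup X p, Φ (MulOpposite.op g) = chainMap hε g.toPath := by
  have hbij : Function.Bijective fun g : (FundamentalGroup X p)ᵐᵒᵖ =>
      (chainMap hε g.unop.toPath : EpsGroup ε p) :=
    ⟨fun g h hgh => MulOpposite.unop_injective
      (chainMap_injective hgeo hr0 hr hε hmem p p hgh), fun a => by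
        obtain ⟨q, hq⟩ := chainMap_surjective hgeo hε p p a
        exact ⟨MulOpposite.op (FundamentalGroup.fromPath q), hq⟩⟩
  exact ⟨⟨Equiv.ofBijective _ hbij, fun g h => chainMap_trans hε _ _⟩, fun g => rfl⟩

/-! ### Free homotopies of loops -/

section Free

variable {X : Type*} [TopologicalSpace X] {x y z : X}

/-- Symmetry and transitivity are inherited from homotopies through maps with equal end values. -/
theorem freelyHomotopic_iff_homotopicWith {c : Path x x} {c' : Path y y} :
    FreelyHomotopic c c' ↔ ContinuousMap.HomotopicWith c.toContinuousMap c'.toContinuousMap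
      fun f => f 0 = f 1 :=
  ⟨fun ⟨H, h0, h1, h⟩ => ⟨⟨⟨H, h0, h1⟩, h⟩⟩,
    fun ⟨H⟩ => ⟨H.toContinuousMap, H.map_zero_left, H.map_one_left, H.prop'⟩⟩

theorem FreelyHomotopic.symm {c : Path x x} {c' : Path y y} (h : FreelyHomotopic c c') :
    FreelyHomotopic c' c := by
  rw [freelyHomotopic_iff_homotopicWith] at h ⊢
  exact h.symm

theorem FreelyHomotopic.trans {c : Path x x} {c' : Path y y} {c'' : Path z z}
    (h : FreelyHomotopic c c') (h' : FreelyHomotopic c' c'') : FreelyHomotopic c c'' := by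
  rw [freelyHomotopic_iff_homotopicWith] at h h' ⊢
  exact h.trans h'

theorem freelyHomotopic_of_homotopic {c c' : Path x x} (h : c.Homotopic c') :
    FreelyHomotopic c c' := by
  obtain ⟨H⟩ := h
  exact ⟨H.toContinuousMap, H.map_zero_left, H.map_one_left,
    fun s => (H.source s).trans (H.target s).symm⟩

/-- Drag the base point along `p`: at time `s` the loop is `c` conjugated by the piece of `p` over
`[0, s]`. -/
theorem freelyHomotopic_conj (c : Path x x) (p : Path x y) :
    FreelyHomotopic c ((p.symm.trans c).trans p) := by
  have hx : p 0 = x := p.source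
  let c₀ : Path (p 0) (p 0) := c.cast hx hx
  let P : (s : I) → Path (p 0) (p s) := fun s => p.subpath 0 s
  have hP : Continuous fun st : I × I => P st.1 st.2 := by
    show Continuous ((fun q : I × I × I => p.subpath q.1 q.2.1 q.2.2) ∘
      fun st : I × I => ((0 : I), st.1, st.2))
    exact p.subpath_continuous_family.comp (by fun_prop)
  have h1 : Continuous fun st : I × I => (((P st.1).symm.trans c₀).trans (P st.1)) st.2 :=
    Path.trans_continuous_family (fun s => (P s).symm.trans c₀)
      (Path.trans_continuous_family (fun s => (P s).symm)
        (Path.symm_continuous_family P hP) (fun _ => c₀)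
        (c₀.continuous.comp continuous_snd)) P hP
  have h2 : FreelyHomotopic (((P 0).symm.trans c₀).trans (P 0))
      (((P 1).symm.trans c₀).trans (P 1)) :=
    ⟨⟨_, h1⟩, fun t => rfl, fun t => rfl, fun s => by simp⟩
  have h3 : P 0 = Path.refl (p 0) := p.subpath_self 0
  have h4 : FreelyHomotopic c c₀ := freelyHomotopic_of_homotopic (Path.Homotopic.refl c)
  have h5 : FreelyHomotopic c₀ (((P 0).symm.trans c₀).trans (P 0)) := by
    apply freelyHomotopic_of_homotopic
    rw [h3, ← Path.Homotopic.Quotient.eq]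
    simp
  -- The two loops have base points `p 1` and `y`, which are different terms; free homotopy sees
  -- only values, so pointwise equality suffices.
  have h6 : ∀ t, (((P 1).symm.trans c₀).trans (P 1)) t = ((p.symm.trans c).trans p) t := by
    intro t
    have h7 : ∀ s, P 1 s = p s := fun s => by simp [P]
    simp only [Path.trans_apply, Path.symm_apply, Function.comp_apply, h7, c₀, Path.cast_coe]
  have h8 : FreelyHomotopic (((P 1).symm.trans c₀).trans (P 1)) ((p.symm.trans c).trans p) := by
    obtain ⟨H, g0, g1, g2⟩ := freelyHomotopic_of_homotopic
      (Path.Homotopic.refl ((p.symm.trans c).trans p))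
    exact ⟨H, fun t => (g0 t).trans (h6 t).symm, g1, g2⟩
  exact ((h4.trans h5).trans h2).trans h8

/-- The hypothesis says that `c'` is the conjugate of `c` by `p`, in the form in which comparisons
of polygons produce it. -/
theorem freelyHomotopic_of_trans_eq {c : Path x x} {c' : Path y y} {p : Path x y}
    (h : (Path.Homotopic.Quotient.mk c).trans (.mk p) =
      (Path.Homotopic.Quotient.mk p).trans (.mk c')) : FreelyHomotopic c c' := by
  refine (freelyHomotopic_conj c p).trans (freelyHomotopic_of_homotopic ?_)
  rw [← Path.Homotopic.Quotient.eq]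
  simp only [Path.Homotopic.Quotient.mk_trans, Path.Homotopic.Quotient.mk_symm,
    Path.Homotopic.Quotient.trans_assoc, h]
  rw [← Path.Homotopic.Quotient.trans_assoc]
  simp

end Free

/-! ### Existence of shortest paths and loops -/

section Existence

variable {X : Type*} [MetricSpace X] {δ r : ℝ} {x y z : X}

/-- A path of length less than `N * δ` can be cut into `N` pieces contained in the closed `δ`-balls
around their initial points. -/
theorem exists_subdivision (c : Path x y) (hδ : 0 < δ) {N : ℕ}
    (hN : pathLength c < ENNReal.ofReal (N * δ)) :
    ∃ t : ℕ → I, t 0 = 0 ∧ t N = 1 ∧ (∀ i, t i ≤ t (i + 1)) ∧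
      ∀ i, ∀ s ∈ Set.Icc (t i) (t (i + 1)), dist (c (t i)) (c s) ≤ δ := by
  have hnext : ∀ u : I, ∃ v : I, u ≤ v ∧ (∀ s ∈ Set.Icc u v, dist (c u) (c s) ≤ δ) ∧
      (v = 1 ∨ δ ≤ dist (c u) (c v)) := by
    intro u
    -- The next subdivision point is the first time at which the path is `δ` away from `c u`, or `1`
    -- if there is none.
    set S : Set I := {s | u ≤ s ∧ (s = 1 ∨ δ ≤ dist (c u) (c s))} with hS
    have hcl : IsClosed S := by
      refine (isClosed_Ici (a := u)).inter (isClosed_singleton.union ?_)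
      exact isClosed_le continuous_const (continuous_const.dist c.continuous)
    obtain ⟨v, hv, hmin⟩ := hcl.isCompact.exists_isLeast ⟨1, u.2.2, Or.inl rfl⟩
    refine ⟨v, hv.1, ?_, hv.2⟩
    have hcl' : IsClosed {s : I | dist (c u) (c s) ≤ δ} :=
      isClosed_le (continuous_const.dist c.continuous) continuous_const
    rcases hv.1.eq_or_lt with rfl | hlt
    · intro s hs
      obtain rfl : s = u := le_antisymm hs.2 hs.1
      simpa using hδ.le
    · have hsub : Set.Ico u v ⊆ {s : I | dist (c u) (c s) ≤ δ} := by
        intro s hs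
        by_contra hcon
        exact absurd (hmin ⟨hs.1, Or.inr (not_le.1 hcon).le⟩) (not_le.2 hs.2)
      have := closure_minimal hsub hcl'
      rwa [closure_Ico hlt.ne] at this
  choose nx hle hball hor using hnext
  let t : ℕ → I := fun i => nx^[i] 0
  have ht : ∀ i, t (i + 1) = nx (t i) := fun i => Function.iterate_succ_apply' nx i 0
  have hmono : Monotone t := monotone_nat_of_le_succ fun i => by rw [ht]; exact hle _
  refine ⟨t, rfl, ?_, fun i => hmono i.le_succ, fun i s hs => hball _ s (by rwa [ht] at hs)⟩
  by_contra hne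
  -- If `1` has not been reached after `N` steps, every step covers distance at least `δ`, so the
  -- length is at least `N * δ`.
  have hd : ∀ i < N, δ ≤ dist (c (t i)) (c (t (i + 1))) := by
    intro i hi
    rw [ht]
    refine (hor (t i)).resolve_left fun h1 => hne ?_
    refine le_antisymm (t N).2.2 ?_
    rw [← h1, ← ht]
    exact hmono hi
  have h1 := sum_dist_le_pathLength c (t := t) (n := N) fun i _ => hmono i.le_succ
  have h2 : (N : ℝ) * δ ≤ ∑ i ∈ Finset.range N, dist (c (t i)) (c (t (i + 1))) := by
    have := Finset.card_nsmul_le_sum (Finset.range N)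
      (fun i => dist (c (t i)) (c (t (i + 1)))) δ fun i hi => hd i (Finset.mem_range.1 hi)
    simpa using this
  exact absurd ((ENNReal.ofReal_le_ofReal h2).trans h1) (not_le.2 hN)

/-- The length of the polygon with vertices `f 0, …, f N`. -/
noncomputable def polygonLength (f : ℕ → X) (N : ℕ) : ℝ :=
  ∑ i ∈ Finset.range N, dist (f i) (f (i + 1))

theorem continuous_polygonLength (N : ℕ) : Continuous fun f : ℕ → X => polygonLength f N :=
  continuous_finsetSum _ fun i _ => (continuous_apply i).dist (continuous_apply (i + 1))

theorem exists_polygon (hgeo : IsGeodesicSpace X) (hr : LoopsNullInBalls X r) (hδ : 0 < δ) (hδr : δ < r) (c : Path x y)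
    {N : ℕ} (hN : pathLength c < ENNReal.ofReal (N * δ)) :
    ∃ f : ℕ → X, f 0 = x ∧ f N = y ∧ (∀ i < N, dist (f i) (f (i + 1)) ≤ δ) ∧
      (PathCover.base x).walk hgeo f N = ⟨y, .mk c⟩ ∧
      ENNReal.ofReal (polygonLength f N) ≤ pathLength c := by
  obtain ⟨t, h0, h1, h2, h3⟩ := exists_subdivision c hδ hN
  refine ⟨fun i => c (t i), by simp [h0], by simp [h1], fun i _ => h3 i _ ⟨h2 i, le_rfl⟩,
    PathCover.walk_eq_mk hgeo hr c h0 h1 (fun i _ => h2 i)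
      fun i _ s hs => (h3 i s hs).trans_lt hδr, sum_dist_le_pathLength c fun i _ => h2 i⟩

theorem exists_path_walk (hgeo : IsGeodesicSpace X) {f : ℕ → X} {N : ℕ} {q : Path.Homotopic.Quotient (f 0) y}
    (h : (PathCover.base (f 0)).walk hgeo f N = ⟨y, q⟩) :
    ∃ c : Path (f 0) y, .mk c = q ∧ pathLength c ≤ ENNReal.ofReal (polygonLength f N) := by
  obtain ⟨c, h1, h2⟩ := PathCover.exists_path_trace hgeo ((List.range N).map fun i => f (i + 1))
    (PathCover.base (f 0)) (Path.refl (f 0)) rfl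
  replace h2 : pathLength c ≤ ENNReal.ofReal (polygonLength f N) := by
    have h0 : pathLength (Path.refl (f 0)) = 0 := (eVariationOn.eq_zero_iff _).2 (by simp)
    refine h2.trans_eq ?_
    erw [h0, zero_add]
    rw [polygonLength, ← listLength_map_range, List.range_succ_eq_map, List.map_cons, List.map_map]
    rfl
  revert c
  rw [PathCover.walk] at h
  rw [h]
  exact fun c h1 h2 => ⟨c, h1, h2⟩

theorem exists_homotopic_pathLength_lt_top (hgeo : IsGeodesicSpace X) (hr0 : 0 < r) (hr : LoopsNullInBalls X r)
    (c : Path x y) : ∃ c' : Path x y, c.Homotopic c' ∧ pathLength c' < ⊤ := by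
  obtain ⟨α, hα⟩ := exists_isSubdivisionChain hr0 c
  obtain ⟨c', h1, h2⟩ := PathCover.exists_path_trace_tail hgeo α
  rw [PathCover.trace_of_isSubdivisionChain hgeo hr le_rfl hα, PathCover.mk_eq_mk_iff,
    Path.Homotopic.Quotient.eq] at h1
  exact ⟨c', h1, h2.trans_lt ENNReal.ofReal_lt_top⟩

theorem exists_nat_pathLength_lt (hδ : 0 < δ) (c : Path x y) (hc : pathLength c < ⊤) :
    ∃ N : ℕ, pathLength c < ENNReal.ofReal (N * δ) := by
  obtain ⟨N, hN⟩ := exists_nat_gt ((pathLength c).toReal / δ)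
  refine ⟨N, ?_⟩
  rw [div_lt_iff₀ hδ] at hN
  rwa [← ENNReal.ofReal_toReal hc.ne, ENNReal.ofReal_lt_ofReal_iff_of_nonneg ENNReal.toReal_nonneg]

theorem exists_mem_forall_dist_lt {K : Set (ℕ → X)} {f : ℕ → X} (hf : f ∈ closure K) (N : ℕ)
    {η : ℝ} (hη : 0 < η) : ∃ g ∈ K, ∀ i ≤ N, dist (f i) (g i) < η := by
  have hopen : IsOpen {g : ℕ → X | ∀ i ∈ Finset.range (N + 1), dist (f i) (g i) < η} := by
    simp only [Set.ofPred_forall]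
    exact isOpen_biInter_finset fun i _ =>
      isOpen_lt (continuous_const.dist (continuous_apply i)) continuous_const
  obtain ⟨g, h1, h2⟩ := mem_closure_iff.1 hf _ hopen fun i _ => by simpa using hη
  exact ⟨g, h2, fun i hi => h1 i (Finset.mem_range.2 (by omega))⟩

theorem isClosed_setOf_steps_le (N : ℕ) (δ : ℝ) :
    IsClosed {f : ℕ → X | ∀ i < N, dist (f i) (f (i + 1)) ≤ δ} := by
  simp only [Set.ofPred_forall]
  exact isClosed_iInter fun i => isClosed_iInter fun _ =>
    isClosed_le ((continuous_apply i).dist (continuous_apply (i + 1))) continuous_const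

/-- Minimize the length over the polygons in the class with `N` sides of length at most `r / 4`.
With `N * (r / 4)` above the length of one competitor, every shorter path is matched by such a
polygon and every longer path is irrelevant. -/
theorem exists_isShortestInClass [CompactSpace X] (hgeo : IsGeodesicSpace X)
    (hr0 : 0 < r) (hr : LoopsNullInBalls X r)
    (c : Path x y) : ∃ c' : Path x y, IsShortestInClass c c' := by
  obtain ⟨c₀, hc₀, hfin⟩ := exists_homotopic_pathLength_lt_top hgeo hr0 hr c
  -- Sides at most `r / 4` form a closed condition and stay strictly below `r / 2`, the bound under
  -- which `walk_snoc_eq` compares polygons.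
  have hδ : 0 < r / 4 := by linarith
  obtain ⟨N, hN⟩ := exists_nat_pathLength_lt hδ c₀ hfin
  set K₀ : Set (ℕ → X) :=
    {f | f 0 = x} ∩ {f | f N = y} ∩ {f | ∀ i < N, dist (f i) (f (i + 1)) ≤ r / 4} with hK₀
  have hcl₀ : IsClosed K₀ :=
    ((isClosed_singleton.preimage (continuous_apply 0)).inter
      (isClosed_singleton.preimage (continuous_apply N))).inter (isClosed_setOf_steps_le N _)
  -- Sequences over all of `ℕ` live in a compact product; the coordinates after `N` are free and
  -- irrelevant.
  set K : Set (ℕ → X) := {f | f ∈ K₀ ∧ (PathCover.base x).walk hgeo f N = ⟨y, .mk c⟩} with hK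
  have hcl : IsClosed K := by
    refine isClosed_of_closure_subset fun f hf => ?_
    have hf₀ : f ∈ K₀ := closure_minimal (fun g hg => hg.1) hcl₀ hf
    obtain ⟨g, ⟨hg₀, hg⟩, hfg⟩ := exists_mem_forall_dist_lt hf N (half_pos hr0)
    refine ⟨hf₀, ?_⟩
    obtain ⟨⟨f0, fN⟩, hfs⟩ := hf₀
    obtain ⟨⟨g0, gN⟩, hgs⟩ := hg₀
    simp only [Set.mem_ofPred_eq] at f0 fN g0 gN hfs hgs
    have h := PathCover.walk_snoc_eq hgeo hr (η := r / 2) (by linarith) (a := PathCover.base x)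
      f0.symm hfg (fun i hi => (hfs i hi).trans_lt (by linarith))
      fun i hi => (hgs i hi).trans_lt (by linarith)
    -- The polygons share both endpoints, so the connecting sides at the two ends are constant.
    rwa [gN, g0, PathCover.snoc_self hgeo (a := PathCover.base x) (z := x) rfl, hg, PathCover.snoc_self] at h
    rw [PathCover.endpoint_walk hgeo (a := PathCover.base x) f0.symm, fN]
  have hmem : ∀ c'' : Path x y, c.Homotopic c'' → pathLength c'' < ENNReal.ofReal (N * (r / 4)) →
      ∃ f ∈ K, ENNReal.ofReal (polygonLength f N) ≤ pathLength c'' := by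
    intro c'' hc'' hlt
    obtain ⟨f, h0, h1, h2, h3, h4⟩ := exists_polygon hgeo hr hδ (by linarith) c'' hlt
    refine ⟨f, ⟨⟨⟨h0, h1⟩, h2⟩, ?_⟩, h4⟩
    rw [h3, PathCover.mk_eq_mk_iff, Path.Homotopic.Quotient.eq]
    exact hc''.symm
  obtain ⟨f₀, hf₀K, hf₀⟩ := hmem c₀ hc₀ hN
  obtain ⟨f, hfK, hmin⟩ := hcl.isCompact.exists_isMinOn ⟨f₀, hf₀K⟩
    (continuous_polygonLength N).continuousOn
  have hle : ∀ c'' : Path x y, c.Homotopic c'' →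
      ENNReal.ofReal (polygonLength f N) ≤ pathLength c'' := by
    intro c'' hc''
    rcases lt_or_ge (pathLength c'') (ENNReal.ofReal (N * (r / 4))) with hlt | hge
    · obtain ⟨g, hg, h⟩ := hmem c'' hc'' hlt
      exact (ENNReal.ofReal_le_ofReal (hmin hg)).trans h
    · exact (((ENNReal.ofReal_le_ofReal (hmin hf₀K)).trans hf₀).trans hN.le).trans hge
  obtain ⟨⟨⟨rfl, -⟩, -⟩, hw⟩ := hfK
  obtain ⟨c', h1, h2⟩ := exists_path_walk hgeo hw
  exact ⟨c', (Path.Homotopic.Quotient.eq.1 h1).symm, fun c'' hc'' => h2.trans (hle c'' hc'')⟩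

theorem exists_isShortestInFreeClass [CompactSpace X] (hgeo : IsGeodesicSpace X)
    (hr0 : 0 < r) (hr : LoopsNullInBalls X r)
    (c : Path x x) : ∃ (y : X) (c' : Path y y), IsShortestInFreeClass c c' := by
  obtain ⟨c₀, hc₀, hfin⟩ := exists_homotopic_pathLength_lt_top hgeo hr0 hr c
  have hδ : 0 < r / 4 := by linarith
  obtain ⟨N, hN⟩ := exists_nat_pathLength_lt hδ c₀ hfin
  set K₀ : Set (ℕ → X) :=
    {f | f N = f 0} ∩ {f | ∀ i < N, dist (f i) (f (i + 1)) ≤ r / 4} with hK₀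
  have hcl₀ : IsClosed K₀ :=
    (isClosed_eq (continuous_apply N) (continuous_apply 0)).inter (isClosed_setOf_steps_le N _)
  set K : Set (ℕ → X) := {f | f ∈ K₀ ∧ ∃ d : Path (f 0) (f 0),
    (PathCover.base (f 0)).walk hgeo f N = ⟨f 0, .mk d⟩ ∧ FreelyHomotopic c d} with hK
  have hcl : IsClosed K := by
    refine isClosed_of_closure_subset fun f hf => ?_
    have hf₀ : f ∈ K₀ := closure_minimal (fun g hg => hg.1) hcl₀ hf
    obtain ⟨g, ⟨hg₀, d, hg, hd⟩, hfg⟩ := exists_mem_forall_dist_lt hf N (half_pos hr0)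
    refine ⟨hf₀, ?_⟩
    obtain ⟨fN, hfs⟩ := hf₀
    obtain ⟨gN, hgs⟩ := hg₀
    simp only [Set.mem_ofPred_eq] at fN gN hfs hgs
    have h := PathCover.walk_snoc_eq hgeo hr (η := r / 2) (by linarith)
      (a := PathCover.base (f 0)) rfl hfg (fun i hi => (hfs i hi).trans_lt (by linarith))
      fun i hi => (hgs i hi).trans_lt (by linarith)
    obtain ⟨e, he⟩ : ∃ e : Path (f 0) (f 0),
        (PathCover.base (f 0)).walk hgeo f N = ⟨f 0, .mk e⟩ := by
      have h1 := (PathCover.endpoint_walk hgeo (a := PathCover.base (f 0)) (f := f) rfl N).trans fN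
      generalize (PathCover.base (f 0)).walk hgeo f N = w at h1
      obtain ⟨v, q⟩ := w
      obtain rfl : v = f 0 := h1
      obtain ⟨e, rfl⟩ := Path.Homotopic.Quotient.mk_surjective q
      exact ⟨e, rfl⟩
    refine ⟨e, he, hd.trans (FreelyHomotopic.symm ?_)⟩
    have h2 : (PathCover.base (f 0)).snoc hgeo (g 0) =
        ⟨g 0, .mk (hgeo.path (f 0) (g 0))⟩ :=
      PathCover.mk_eq_mk_iff.2 (Path.Homotopic.Quotient.refl_trans _)
    -- Here the base points differ: the comparison reads `e` followed by the geodesic from `f 0` to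
    -- `g 0` equals that geodesic followed by `d`, so `e` and `d` are freely homotopic.
    rw [gN, he, h2, PathCover.walk_eq_translate] at h
    have h3 : (⟨g 0, .mk (hgeo.path (f 0) (g 0))⟩ : PathCover (f 0)).translate
        ((PathCover.base (g 0)).walk hgeo g N) =
        ⟨g 0, (Path.Homotopic.Quotient.mk (hgeo.path (f 0) (g 0))).trans (.mk d)⟩ := by
      rw [hg]
      rfl
    exact freelyHomotopic_of_trans_eq (PathCover.mk_eq_mk_iff.1 (h.trans h3))
  have hmem : ∀ (z : X) (c'' : Path z z), FreelyHomotopic c c'' →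
      pathLength c'' < ENNReal.ofReal (N * (r / 4)) →
      ∃ f ∈ K, ENNReal.ofReal (polygonLength f N) ≤ pathLength c'' := by
    intro z c'' hc'' hlt
    obtain ⟨f, h0, h1, h2, h3, h4⟩ := exists_polygon hgeo hr hδ (by linarith) c'' hlt
    subst h0
    exact ⟨f, ⟨⟨h1, h2⟩, c'', h3, hc''⟩, h4⟩
  obtain ⟨f₀, hf₀K, hf₀⟩ := hmem x c₀ (freelyHomotopic_of_homotopic hc₀) hN
  obtain ⟨f, hfK, hmin⟩ := hcl.isCompact.exists_isMinOn ⟨f₀, hf₀K⟩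
    (continuous_polygonLength N).continuousOn
  have hle : ∀ (z : X) (c'' : Path z z), FreelyHomotopic c c'' →
      ENNReal.ofReal (polygonLength f N) ≤ pathLength c'' := by
    intro z c'' hc''
    rcases lt_or_ge (pathLength c'') (ENNReal.ofReal (N * (r / 4))) with hlt | hge
    · obtain ⟨g, hg, h⟩ := hmem z c'' hc'' hlt
      exact (ENNReal.ofReal_le_ofReal (hmin hg)).trans h
    · exact (((ENNReal.ofReal_le_ofReal (hmin hf₀K)).trans hf₀).trans hN.le).trans hge
  obtain ⟨-, d, hw, hd⟩ := hfK
  obtain ⟨c', h1, h2⟩ := exists_path_walk hgeo hw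
  exact ⟨f 0, c', hd.trans (freelyHomotopic_of_homotopic (Path.Homotopic.Quotient.eq.1 h1).symm),
    fun z c'' hc'' => h2.trans (hle z c'' hc'')⟩

end Existence

/-! ### Shortest paths and loops are geodesics -/

theorem mk_subpath_trans {X : Type*} [TopologicalSpace X] {x y : X} (c : Path x y) (s t : I) :
    ((Path.Homotopic.Quotient.mk ((c.subpath 0 s).cast c.source.symm rfl)).trans
      (.mk (c.subpath s t))).trans (.mk ((c.subpath t 1).cast rfl c.target.symm)) = .mk c := by
  have h : (((c.subpath 0 s).trans (c.subpath s t)).trans (c.subpath t 1)).Homotopic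
      (c.subpath 0 1) :=
    (Path.Homotopic.hcomp ⟨Path.Homotopy.subpathTransSubpath c 0 s t⟩ (.refl _)).trans
      ⟨Path.Homotopy.subpathTransSubpath c 0 t 1⟩
  have h1 := h.pathCast c.source.symm c.target.symm
  rw [Path.subpath_zero_one] at h1
  exact Path.Homotopic.Quotient.eq.2 h1

section Shortest

variable {X : Type*} [MetricSpace X] {r ℓ : ℝ} {x y z : X}

theorem IsShortestInClass.of_homotopic {c₀ c g : Path x y} (hc : IsShortestInClass c₀ c)
    (hg : c.Homotopic g) (hle : pathLength g ≤ pathLength c) : IsShortestInClass c₀ g :=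
  ⟨hc.1.trans hg, fun c'' h => hle.trans (hc.2 c'' h)⟩

theorem IsShortestInFreeClass.of_homotopic {c₀ : Path x x} {c g : Path y y}
    (hc : IsShortestInFreeClass c₀ c) (hg : c.Homotopic g) (hle : pathLength g ≤ pathLength c) :
    IsShortestInFreeClass c₀ g :=
  ⟨hc.1.trans (freelyHomotopic_of_homotopic hg), fun z c'' h => hle.trans (hc.2 z c'' h)⟩

theorem IsShortestInFreeClass.isShortestInClass {c₀ : Path x x} {c : Path y y}
    (hc : IsShortestInFreeClass c₀ c) : IsShortestInClass c c :=
  ⟨.refl c, fun c'' h => hc.2 y c'' (hc.1.trans (freelyHomotopic_of_homotopic h))⟩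

theorem IsShortestInClass.pathLength_lt_top (hgeo : IsGeodesicSpace X) (hr0 : 0 < r)
    (hr : LoopsNullInBalls X r) {c₀ c : Path x y} (hc : IsShortestInClass c₀ c) :
    pathLength c < ⊤ := by
  obtain ⟨c', h1, h2⟩ := exists_homotopic_pathLength_lt_top hgeo hr0 hr c₀
  exact (hc.2 c' h1).trans_lt h2

theorem exists_dist_lt (hr0 : 0 < r) (c : Path x y) :
    ∃ η : ℝ, 0 < η ∧ ∀ s t : I, |(s : ℝ) - t| < η → dist (c s) (c t) < r := by
  obtain ⟨η, hη, h⟩ := Metric.uniformContinuous_iff.1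
    (CompactSpace.uniformContinuous_of_continuous c.continuous) r hr0
  exact ⟨η, hη, fun s t hst => h hst⟩

/-- Short pieces of a shortest path are as long as the distance of their endpoints. -/
theorem IsShortestInClass.eVariationOn_eq (hgeo : IsGeodesicSpace X) (hr0 : 0 < r)
    (hr : LoopsNullInBalls X r) {c₀ c : Path x y} (hc : IsShortestInClass c₀ c) {s t : I}
    (hst : s ≤ t) (hball : ∀ u ∈ Set.Icc s t, dist (c s) (c u) < r) :
    eVariationOn c (Set.Icc s t) = edist (c s) (c t) := by
  refine le_antisymm ?_ (edist_le_eVariationOn c hst)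
  set a : Path x (c s) := (c.subpath 0 s).cast c.source.symm rfl
  set b : Path (c t) y := (c.subpath t 1).cast rfl c.target.symm
  have h1 : (c.subpath s t).Homotopic (hgeo.path (c s) (c t)) := by
    refine hr.homotopic (z := c s) ?_ ?_
    · rw [Path.range_subpath_of_le _ _ _ hst]
      rintro _ ⟨u, hu, rfl⟩
      rw [Metric.mem_ball, dist_comm]
      exact hball u hu
    · apply hgeo.range_path_subset
      rw [dist_self, zero_add]
      exact hball t ⟨hst, le_rfl⟩
  have h2 : c.Homotopic ((a.trans (hgeo.path (c s) (c t))).trans b) := by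
    rw [← Path.Homotopic.Quotient.eq, ← mk_subpath_trans c s t,
      Path.Homotopic.Quotient.eq.2 h1]
    rfl
  have h3 := hc.2 _ (hc.1.trans h2)
  have h0s : (0 : I) ≤ s := s.2.1
  have ht1 : t ≤ (1 : I) := t.2.2
  have ha : pathLength a = eVariationOn c (Set.Icc 0 s) := pathLength_subpath c h0s
  have hb : pathLength b = eVariationOn c (Set.Icc t 1) := pathLength_subpath c ht1
  have hfin := hc.pathLength_lt_top hgeo hr0 hr
  rw [pathLength_trans, pathLength_trans, ha, hb] at h3
  rw [pathLength_eq, ← eVariationOn_add c (h0s.trans hst) ht1, ← eVariationOn_add c h0s hst]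
    at h3 hfin
  -- Finiteness of the outer pieces permits their cancellation from the length inequality.
  rw [ENNReal.add_lt_top, ENNReal.add_lt_top] at hfin
  rw [ENNReal.add_le_add_iff_right hfin.2.ne, ENNReal.add_le_add_iff_left hfin.1.1.ne] at h3
  rw [edist_dist]
  exact h3.trans (hgeo.pathLength_path_le _ _)

/-- A shortest path with a Lipschitz constant equal to its length is locally minimizing. -/
theorem IsShortestInClass.exists_dist_eq (hgeo : IsGeodesicSpace X) (hr0 : 0 < r)
    (hr : LoopsNullInBalls X r) {c₀ g : Path x y} (hg : IsShortestInClass c₀ g) (hℓ : 0 < ℓ)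
    (hlen : pathLength g = ENNReal.ofReal ℓ)
    (hlip : ∀ s t : I, dist (g s) (g t) ≤ ℓ * |(s : ℝ) - t|) :
    ∃ η : ℝ, 0 < η ∧ ∀ s t : I, |(s : ℝ) - t| < η → dist (g s) (g t) = ℓ * |(s : ℝ) - t| := by
  obtain ⟨η, hη, hd⟩ := exists_dist_lt hr0 g
  refine ⟨η, hη, ?_⟩
  have key : ∀ s t : I, s ≤ t → |(s : ℝ) - t| < η → dist (g s) (g t) = ℓ * |(s : ℝ) - t| := by
    intro s t hst h
    refine le_antisymm (hlip s t) ?_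
    have hst' : (s : ℝ) ≤ t := hst
    have h0s : (0 : I) ≤ s := s.2.1
    have ht1 : t ≤ (1 : I) := t.2.2
    have h1 : eVariationOn g (Set.Icc s t) = edist (g s) (g t) := by
      refine hg.eVariationOn_eq hgeo hr0 hr hst fun u hu => hd s u (lt_of_le_of_lt ?_ h)
      have h2 : (s : ℝ) ≤ u := hu.1
      have h3 : (u : ℝ) ≤ t := hu.2
      rw [abs_sub_comm, abs_of_nonneg (by linarith), abs_sub_comm, abs_of_nonneg (by linarith)]
      linarith
    -- The outer pieces have length at most `ℓ * s` and `ℓ * (1 - t)`; as the total is `ℓ`, the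
    -- middle piece has length at least `ℓ * (t - s)`.
    have h4 := eVariationOn_le_of_lipschitz g hℓ.le hlip h0s
    have h5 := eVariationOn_le_of_lipschitz g hℓ.le hlip ht1
    rw [pathLength_eq, ← eVariationOn_add g (h0s.trans hst) ht1, ← eVariationOn_add g h0s hst, h1,
      edist_dist] at hlen
    have h6 := add_le_add (add_le_add_left h4 (ENNReal.ofReal (dist (g s) (g t)))) h5
    have h7 : (0 : ℝ) ≤ s := s.2.1
    have h8 : (t : ℝ) ≤ 1 := t.2.2
    simp only [Set.Icc.coe_zero, Set.Icc.coe_one, sub_zero] at h6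
    rw [hlen, ← ENNReal.ofReal_add (by positivity) dist_nonneg,
      ← ENNReal.ofReal_add (by positivity) (mul_nonneg hℓ.le (by linarith)),
      ENNReal.ofReal_le_ofReal_iff (by
        have := mul_nonneg hℓ.le (sub_nonneg.2 h8)
        positivity)] at h6
    rw [abs_sub_comm, abs_of_nonneg (by linarith)]
    linarith
  intro s t h
  rcases le_total s t with hst | hst
  · exact key s t hst h
  · rw [dist_comm, abs_sub_comm]
    exact key t s hst (by rwa [abs_sub_comm])

/-- Shortest paths can be parametrized with constant speed. -/
theorem IsShortestInClass.exists_constant_speed (hgeo : IsGeodesicSpace X) (hr0 : 0 < r)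
    (hr : LoopsNullInBalls X r) {c₀ c : Path x y} (hc : IsShortestInClass c₀ c)
    (hne : ¬ IsConstantPath c) :
    ∃ (ℓ : ℝ) (g : Path x y), 0 < ℓ ∧ IsReparametrization c g ∧ c.Homotopic g ∧
      pathLength g = ENNReal.ofReal ℓ ∧ pathLength g = pathLength c ∧
      ∀ s t : I, dist (g s) (g t) ≤ ℓ * |(s : ℝ) - t| := by
  have hfin := hc.pathLength_lt_top hgeo hr0 hr
  set ℓ := (pathLength c).toReal with hℓdef
  have hℓ : 0 < ℓ := ENNReal.toReal_pos
    (fun h => hne (isConstantPath_of_pathLength_eq_zero c h)) hfin.ne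
  have hlen : pathLength c = ENNReal.ofReal ℓ := (ENNReal.ofReal_toReal hfin.ne).symm
  have hVfin : ∀ s t : I, eVariationOn c (Set.Icc s t) ≠ ⊤ := fun s t =>
    ((eVariationOn.mono c (Set.subset_univ _)).trans_lt hfin).ne
  set v : I → ℝ := fun t => (eVariationOn c (Set.Icc 0 t)).toReal with hv
  have hvsub : ∀ s t : I, s ≤ t → v t - v s = (eVariationOn c (Set.Icc s t)).toReal := by
    intro s t hst
    simp only [hv]
    rw [← eVariationOn_add c s.2.1 hst, ENNReal.toReal_add (hVfin _ _) (hVfin _ _)]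
    ring
  have hvmono : Monotone v := fun s t hst => by
    rw [← sub_nonneg, hvsub s t hst]
    exact ENNReal.toReal_nonneg
  have hv0 : v 0 = 0 := by
    simp only [hv]
    rw [Set.Icc_self, eVariationOn.subsingleton c Set.subsingleton_singleton, ENNReal.toReal_zero]
  have hv1 : v 1 = ℓ := by rw [hℓdef, pathLength_eq]
  have hdist : ∀ s t : I, dist (c s) (c t) ≤ |v s - v t| := by
    have key : ∀ s t : I, s ≤ t → dist (c s) (c t) ≤ |v s - v t| := by
      intro s t hst
      rw [abs_sub_comm, abs_of_nonneg (sub_nonneg.2 (hvmono hst)), hvsub s t hst, dist_edist]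
      exact ENNReal.toReal_mono (hVfin _ _) (edist_le_eVariationOn c hst)
    intro s t
    rcases le_total s t with h | h
    · exact key s t h
    · rw [dist_comm, abs_sub_comm]
      exact key t s h
  obtain ⟨η, hη, hd⟩ := exists_dist_lt hr0 c
  have hloc : ∀ s t : I, |(s : ℝ) - t| < η → |v s - v t| = dist (c s) (c t) := by
    have key : ∀ s t : I, s ≤ t → |(s : ℝ) - t| < η → |v s - v t| = dist (c s) (c t) := by
      intro s t hst h
      rw [abs_sub_comm, abs_of_nonneg (sub_nonneg.2 (hvmono hst)), hvsub s t hst, dist_edist,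
        hc.eVariationOn_eq hgeo hr0 hr hst fun u hu => hd s u (lt_of_le_of_lt ?_ h)]
      have h2 : (s : ℝ) ≤ u := hu.1
      have h3 : (u : ℝ) ≤ t := hu.2
      rw [abs_sub_comm, abs_of_nonneg (by linarith), abs_sub_comm, abs_of_nonneg (by linarith)]
      linarith
    intro s t h
    rcases le_total s t with hst | hst
    · exact key s t hst h
    · rw [dist_comm, abs_sub_comm]
      exact key t s hst (by rwa [abs_sub_comm])
  -- Locally the increments of arclength are distances along `c`, so continuity of `c` carries over
  -- to `v`.
  have hvcont : Continuous v := by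
    refine Metric.continuous_iff.2 fun t e he => ?_
    obtain ⟨d, hd0, hd'⟩ := Metric.continuous_iff.1 c.continuous t e he
    refine ⟨min d η, lt_min hd0 hη, fun s hs => ?_⟩
    rw [Real.dist_eq, hloc s t (hs.trans_le (min_le_right _ _))]
    exact hd' s (hs.trans_le (min_le_left _ _))
  have hmem : ∀ t, v t / ℓ ∈ I := fun t =>
    ⟨div_nonneg ENNReal.toReal_nonneg hℓ.le,
      (div_le_one hℓ).2 (hv1 ▸ hvmono (show t ≤ (1 : I) from t.2.2))⟩
  set φ : I → I := fun t => ⟨v t / ℓ, hmem t⟩ with hφ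
  have hφcont : Continuous φ := (hvcont.div_const ℓ).subtype_mk _
  have hφ0 : φ 0 = 0 := by ext; simp [hφ, hv0]
  have hφ1 : φ 1 = 1 := by ext; simp [hφ, hv1, hℓ.ne']
  have hφv : ∀ s t, ℓ * |(φ s : ℝ) - φ t| = |v s - v t| := by
    intro s t
    simp only [hφ]
    rw [← sub_div, abs_div, abs_of_pos hℓ]
    field_simp
  have hsurj : ∀ u, ∃ t, φ t = u := fun u =>
    mem_range_of_exists_le_of_exists_ge hφcont ⟨0, hφ0.le.trans u.2.1⟩
      ⟨1, le_trans (show u ≤ (1 : I) from u.2.2) hφ1.ge⟩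
  -- Any section of `φ` will do, continuous or not: `c` is constant wherever arclength is, so `c ∘
  -- τ` does not depend on the choice.
  choose τ hτ using hsurj
  have hlip : ∀ s t : I, dist (c (τ s)) (c (τ t)) ≤ ℓ * |(s : ℝ) - t| := by
    intro s t
    have := hdist (τ s) (τ t)
    rwa [← hφv, hτ, hτ] at this
  have hcτ : ∀ t, c t = c (τ (φ t)) := by
    intro t
    have := hdist t (τ (φ t))
    rw [← hφv, hτ, sub_self, abs_zero, mul_zero] at this
    exact dist_le_zero.1 this
  have hcont : Continuous fun s => c (τ s) :=
    (LipschitzWith.of_dist_le_mul (K := ℓ.toNNReal) fun s t => by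
      rw [Real.coe_toNNReal _ hℓ.le]
      exact hlip s t).continuous
  let g : Path x y := ⟨⟨fun s => c (τ s), hcont⟩, by
    show c (τ 0) = x
    rw [← hφ0, ← hcτ, c.source], by
    show c (τ 1) = y
    rw [← hφ1, ← hcτ, c.target]⟩
  have hcg : c.Homotopic g := by
    have h1 : c = g.reparam φ hφcont hφ0 hφ1 := Path.ext (funext hcτ)
    rw [h1]
    exact ⟨(Path.Homotopy.reparam g φ hφcont hφ0 hφ1).symm⟩
  have hle : pathLength g ≤ pathLength c := by
    rw [hlen]
    exact pathLength_le_of_lipschitz g hℓ.le hlip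
  have heq : pathLength g = pathLength c := le_antisymm hle (hc.2 g (hc.1.trans hcg))
  refine ⟨ℓ, g, hℓ, ⟨φ, hφcont, fun s t hst => ?_, hφ0, hφ1, hcτ⟩, hcg, heq.trans hlen, heq, hlip⟩
  exact div_le_div_of_nonneg_right (hvmono hst) hℓ.le

theorem isLocallyMinimizing_of_dist_eq {g : Path x y} (hℓ : 0 < ℓ) {η : ℝ} (hη : 0 < η)
    (h : ∀ s t : I, |(s : ℝ) - t| < η → dist (g s) (g t) = ℓ * |(s : ℝ) - t|) :
    IsLocallyMinimizing g := by
  refine ⟨ℓ, hℓ, fun t => ⟨Metric.ball t (η / 2), Metric.ball_mem_nhds t (by linarith),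
    fun s hs s' hs' => h s s' ?_⟩⟩
  have h1 := dist_triangle_right s s' t
  rw [Metric.mem_ball] at hs hs'
  rw [← Real.dist_eq, ← Subtype.dist_eq]
  linarith

theorem IsShortestInClass.constant_or_exists (hgeo : IsGeodesicSpace X) (hr0 : 0 < r)
    (hr : LoopsNullInBalls X r) {c₀ c : Path x y} (hc : IsShortestInClass c₀ c) :
    IsConstantPath c ∨ ∃ g : Path x y, IsLocallyMinimizing g ∧ IsReparametrization c g ∧
      IsShortestInClass c₀ g := by
  refine or_iff_not_imp_left.2 fun hne => ?_
  obtain ⟨ℓ, g, hℓ, hrep, hcg, hlen, heq, hlip⟩ := hc.exists_constant_speed hgeo hr0 hr hne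
  have hg := hc.of_homotopic hcg heq.le
  obtain ⟨η, hη, h⟩ := hg.exists_dist_eq hgeo hr0 hr hℓ hlen hlip
  exact ⟨g, isLocallyMinimizing_of_dist_eq hℓ hη h, hrep, hg⟩

/-- Short pieces of a shortest loop around its base point are minimizing. -/
theorem IsShortestInFreeClass.exists_dist_eq (hgeo : IsGeodesicSpace X) (hr0 : 0 < r)
    (hr : LoopsNullInBalls X r) {c₀ : Path x x} {g : Path y y} (hg : IsShortestInFreeClass c₀ g)
    (hℓ : 0 < ℓ) (hlen : pathLength g = ENNReal.ofReal ℓ)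
    (hlip : ∀ s t : I, dist (g s) (g t) ≤ ℓ * |(s : ℝ) - t|) :
    ∃ η : ℝ, 0 < η ∧ ∀ u v : I, u ≤ v → 1 - ((v : ℝ) - u) < η →
      dist (g u) (g v) = ℓ * (1 - ((v : ℝ) - u)) := by
  -- The arc through the base point then has length below `r / 4`, so it and the geodesic joining
  -- its ends lie in the `r`-ball around `y`.
  refine ⟨r / (4 * ℓ), by positivity, fun u v huv h => ?_⟩
  have huv' : (u : ℝ) ≤ v := huv
  have hu0 : (0 : ℝ) ≤ u := u.2.1
  have hv1 : (v : ℝ) ≤ 1 := v.2.2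
  have h' : ℓ * (1 - (v - u)) < r / 4 := by
    calc ℓ * (1 - (v - u)) < ℓ * (r / (4 * ℓ)) := mul_lt_mul_of_pos_left h hℓ
      _ = r / 4 := by field_simp
  have hstart : ∀ t : I, dist y (g t) ≤ ℓ * t := by
    intro t
    have := hlip 0 t
    rw [g.source] at this
    simpa [abs_of_nonneg t.2.1] using this
  have hend : ∀ t : I, dist y (g t) ≤ ℓ * (1 - t) := by
    intro t
    have := hlip 1 t
    rw [g.target] at this
    have ht : (t : ℝ) ≤ 1 := t.2.2
    rwa [Set.Icc.coe_one, abs_of_nonneg (by linarith)] at this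
  have hguv : dist (g u) (g v) ≤ ℓ * (1 - (v - u)) := by
    have := dist_triangle_left (g u) (g v) y
    have := hstart u
    have := hend v
    linarith
  refine le_antisymm hguv ?_
  set a : Path y (g u) := (g.subpath 0 u).cast g.source.symm rfl
  set b : Path (g v) y := (g.subpath v 1).cast rfl g.target.symm
  have hu : (0 : I) ≤ u := hu0
  have hv : v ≤ (1 : I) := hv1
  have h1 : (b.trans a).Homotopic (hgeo.path (g v) (g u)) := by
    refine hr.homotopic (z := y) (range_trans_subset ?_ ?_) ?_
    · rintro _ ⟨s, rfl⟩
      obtain ⟨t, ht, ht'⟩ : g.subpath v 1 s ∈ g '' Set.Icc v 1 := by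
        rw [← Path.range_subpath_of_le g v 1 hv]
        exact ⟨s, rfl⟩
      rw [Metric.mem_ball, dist_comm]
      show dist y (g.subpath v 1 s) < r
      rw [← ht']
      have h2 := hend t
      have h3 : (v : ℝ) ≤ t := ht.1
      nlinarith
    · rintro _ ⟨s, rfl⟩
      obtain ⟨t, ht, ht'⟩ : g.subpath 0 u s ∈ g '' Set.Icc 0 u := by
        rw [← Path.range_subpath_of_le g 0 u hu]
        exact ⟨s, rfl⟩
      rw [Metric.mem_ball, dist_comm]
      show dist y (g.subpath 0 u s) < r
      rw [← ht']
      have h2 := hstart t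
      have h3 : (t : ℝ) ≤ u := ht.2
      nlinarith
    · apply hgeo.range_path_subset
      rw [dist_comm (g v)]
      have := hend v
      nlinarith
  -- Move the base point from `y` to `g u` and replace the arc through `y` by a geodesic. The length
  -- of this competitor bounds `dist (g u) (g v)` from below.
  have h2 : FreelyHomotopic g ((g.subpath u v).trans (hgeo.path (g v) (g u))) := by
    apply freelyHomotopic_of_trans_eq (p := a)
    rw [← mk_subpath_trans g u v, Path.Homotopic.Quotient.mk_trans,
      ← Path.Homotopic.Quotient.eq.2 h1, Path.Homotopic.Quotient.mk_trans]
    simp only [Path.Homotopic.Quotient.trans_assoc]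
    rfl
  have h3 := hg.2 _ _ (hg.1.trans h2)
  rw [hlen, pathLength_trans, pathLength_subpath g huv] at h3
  have h4 := h3.trans (add_le_add (eVariationOn_le_of_lipschitz g hℓ.le hlip huv)
    (hgeo.pathLength_path_le (g v) (g u)))
  have h5 : 0 ≤ ℓ * ((v : ℝ) - u) := mul_nonneg hℓ.le (by linarith)
  rw [← ENNReal.ofReal_add h5 dist_nonneg, ENNReal.ofReal_le_ofReal_iff (by positivity),
    dist_comm] at h4
  linarith

theorem norm_coe_addCircle (hℓ : 0 < ℓ) {w : ℝ} (h0 : 0 ≤ w) (h1 : w ≤ 1) :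
    ‖((ℓ * w : ℝ) : AddCircle ℓ)‖ = ℓ * min w (1 - w) := by
  rcases le_total w (1 - w) with h | h
  · rw [min_eq_left h, (AddCircle.norm_coe_eq_abs_iff ℓ hℓ.ne').2, abs_of_nonneg (by positivity)]
    rw [abs_of_nonneg (by positivity), abs_of_pos hℓ]
    nlinarith
  · have h2 : ((ℓ * w : ℝ) : AddCircle ℓ) = -((ℓ * (1 - w) : ℝ) : AddCircle ℓ) := by
      rw [eq_neg_iff_add_eq_zero, ← AddCircle.coe_add, ← AddCircle.coe_period ℓ]
      congr 1
      ring
    have h3 : 0 ≤ 1 - w := by linarith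
    rw [min_eq_right h, h2, norm_neg, (AddCircle.norm_coe_eq_abs_iff ℓ hℓ.ne').2,
      abs_of_nonneg (by positivity)]
    rw [abs_of_nonneg (by positivity), abs_of_pos hℓ]
    nlinarith

/-- The shorter arc between two points of the circle either stays inside the parameter interval or
passes through the base point; the two hypotheses treat these cases. -/
theorem isClosedGeodesic_of_dist_eq {g : Path y y} (hℓ : 0 < ℓ) {η : ℝ} (hη : 0 < η)
    (h : ∀ s t : I, |(s : ℝ) - t| < η → dist (g s) (g t) = ℓ * |(s : ℝ) - t|)
    {η' : ℝ} (hη' : 0 < η') (h' : ∀ u v : I, u ≤ v → 1 - ((v : ℝ) - u) < η' →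
      dist (g u) (g v) = ℓ * (1 - ((v : ℝ) - u))) : IsClosedGeodesic g := by
  have : Fact (0 < ℓ) := ⟨hℓ⟩
  let γ : AddCircle ℓ → X :=
    AddCircle.liftIco ℓ 0 fun s => g (Set.projIcc 0 1 zero_le_one (s / ℓ))
  have hγ : ∀ t : I, g t = γ ((ℓ * (t : ℝ) : ℝ) : AddCircle ℓ) := by
    have hlt : ∀ t : I, (t : ℝ) < 1 → γ ((ℓ * (t : ℝ) : ℝ) : AddCircle ℓ) = g t := by
      intro t ht
      have hm : ℓ * (t : ℝ) ∈ Set.Ico 0 (0 + ℓ) :=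
        ⟨mul_nonneg hℓ.le t.2.1, by rw [zero_add]; nlinarith⟩
      simp only [γ]
      rw [AddCircle.liftIco_coe_apply hm, mul_div_cancel_left₀ _ hℓ.ne', Set.projIcc_val]
    intro t
    rcases lt_or_eq_of_le t.2.2 with ht | ht
    · exact (hlt t ht).symm
    -- The lift is defined from `[0, ℓ)`, so at `t = 1` the value is that at `0`, and `g` is a loop.
    · have h0 := hlt 0 (by simp)
      have ht1 : t = 1 := Subtype.ext ht
      rw [Set.Icc.coe_zero, mul_zero, g.source] at h0
      rw [ht1, g.target, Set.Icc.coe_one, mul_one, AddCircle.coe_period, ← h0]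
      rfl
  have hrep : ∀ s : AddCircle ℓ, ∃ u : I, s = ((ℓ * (u : ℝ) : ℝ) : AddCircle ℓ) := by
    intro s
    have hs : s ∈ ((↑) : ℝ → AddCircle ℓ) '' Set.Ico 0 (0 + ℓ) := by
      rw [AddCircle.coe_image_Ico_eq]
      trivial
    obtain ⟨w, hw, rfl⟩ := hs
    rw [zero_add] at hw
    refine ⟨⟨w / ℓ, div_nonneg hw.1 hℓ.le, (div_le_one hℓ).2 hw.2.le⟩, ?_⟩
    congr 1
    field_simp
  have key : ∀ u v : I, u ≤ v → dist ((ℓ * (u : ℝ) : ℝ) : AddCircle ℓ) ((ℓ * (v : ℝ) : ℝ)) <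
      ℓ * min η η' → dist (g u) (g v) =
        dist ((ℓ * (u : ℝ) : ℝ) : AddCircle ℓ) ((ℓ * (v : ℝ) : ℝ)) := by
    intro u v huv
    have huv' : (u : ℝ) ≤ v := huv
    have hu0 : (0 : ℝ) ≤ u := u.2.1
    have hv1 : (v : ℝ) ≤ 1 := v.2.2
    rw [dist_comm ((ℓ * (u : ℝ) : ℝ) : AddCircle ℓ), dist_eq_norm, ← AddCircle.coe_sub,
      ← mul_sub, norm_coe_addCircle hℓ (by linarith) (by linarith),
      mul_lt_mul_iff_right₀ hℓ, lt_min_iff]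
    rintro ⟨h1, h2⟩
    rcases le_total ((v : ℝ) - u) (1 - (v - u)) with h3 | h3
    · rw [min_eq_left h3] at h1 ⊢
      have h4 : |(u : ℝ) - v| = v - u := by rw [abs_sub_comm, abs_of_nonneg (by linarith)]
      rw [h u v (by rwa [h4]), h4]
    · rw [min_eq_right h3] at h2 ⊢
      exact h' u v huv h2
  refine ⟨ℓ, hℓ, γ, ⟨ℓ * min η η', mul_pos hℓ (lt_min hη hη'), fun s t hst => ?_⟩, hγ⟩
  obtain ⟨u, rfl⟩ := hrep s
  obtain ⟨v, rfl⟩ := hrep t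
  rw [← hγ, ← hγ]
  rcases le_total u v with huv | huv
  · exact key u v huv hst
  · rw [dist_comm, dist_comm ((ℓ * (u : ℝ) : ℝ) : AddCircle ℓ)]
    exact key v u huv (by rwa [dist_comm])

theorem IsShortestInFreeClass.constant_or_exists (hgeo : IsGeodesicSpace X) (hr0 : 0 < r)
    (hr : LoopsNullInBalls X r) {c₀ : Path x x} {c : Path y y} (hc : IsShortestInFreeClass c₀ c) :
    IsConstantPath c ∨ ∃ g : Path y y, IsClosedGeodesic g ∧ IsReparametrization c g ∧
      IsShortestInFreeClass c₀ g := by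
  refine or_iff_not_imp_left.2 fun hne => ?_
  obtain ⟨ℓ, g, hℓ, hrep, hcg, hlen, heq, hlip⟩ :=
    hc.isShortestInClass.exists_constant_speed hgeo hr0 hr hne
  have hg := hc.of_homotopic hcg heq.le
  obtain ⟨η, hη, h⟩ := hg.isShortestInClass.exists_dist_eq hgeo hr0 hr hℓ hlen hlip
  obtain ⟨η', hη', h'⟩ := hg.exists_dist_eq hgeo hr0 hr hℓ hlen hlip
  exact ⟨g, isClosedGeodesic_of_dist_eq hℓ hη h hη' h', hrep, hg⟩

end Shortest

end DiscreteHomotopy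

theorem theorem2 {X : Type*} [MetricSpace X] [CompactSpace X]
    (hgeo : IsGeodesicSpace X) (hslsc : IsSemilocallySimplyConnected X) :
    -- the homotopy critical spectrum has a positive lower bound
    (∃ ε : ℝ, 0 < ε ∧ ε ∈ lowerBounds (homotopyCriticalSpectrum X)) ∧
    -- consequences for an arbitrary positive lower bound
    ∀ (ε : ℝ) (hε : 0 < ε), ε ∈ lowerBounds (homotopyCriticalSpectrum X) →
      -- (1) the endpoint map is the universal covering map, for every base point
      (∀ p : X, IsUniversalCoveringMap (endpointMap ε p)) ∧
      -- (2) `Λ` preserves lengths of all classes of paths ...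
      (∀ (x y : X) (q : Path.Homotopic.Quotient x y),
        pathClassNorm q = ENNReal.ofReal (chainMap hε q).norm) ∧
      -- ... and is an isomorphism from the fundamental group onto `π_ε`, for every base point
      -- (the product `g * h` of `FundamentalGroup X p` is "`h` followed by `g`", so that the
      -- fundamental group with the concatenation product is its opposite)
      (∀ p : X, ∃ Φ : (FundamentalGroup X p)ᵐᵒᵖ ≃* EpsGroup ε p,
        ∀ g : FundamentalGroup X p, Φ (MulOpposite.op g) = chainMap hε g.toPath) ∧
      -- (3) shortest paths in fixed-endpoint homotopy classes
      (∀ (x y : X) (c : Path x y),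
        (∃ c' : Path x y, IsShortestInClass c c' ∧
          (IsConstantPath c' ∨ IsLocallyMinimizing c')) ∧
        ∀ c' : Path x y, IsShortestInClass c c' →
          IsConstantPath c' ∨ ∃ g : Path x y, IsLocallyMinimizing g ∧ IsReparametrization c' g) ∧
      -- (4) shortest loops in free homotopy classes
      (∀ (x : X) (c : Path x x),
        (∃ (y : X) (c' : Path y y), IsShortestInFreeClass c c' ∧
          (IsConstantPath c' ∨ IsClosedGeodesic c')) ∧
        ∀ (y : X) (c' : Path y y), IsShortestInFreeClass c c' →
          IsConstantPath c' ∨ ∃ g : Path y y, IsClosedGeodesic g ∧ IsReparametrization c' g) := by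
  obtain ⟨r, hr0, hr⟩ := exists_loopsNullInBalls hgeo hslsc
  refine ⟨⟨r / 2, half_pos hr0, mem_lowerBounds_homotopyCriticalSpectrum hgeo hr⟩,
    fun ε hε hmem => ⟨isUniversalCoveringMap_endpointMap hgeo hr0 hr hε hmem,
      fun x y q => pathClassNorm_eq hgeo hr0 hr hε hmem q,
      exists_mulEquiv_chainMap hgeo hr0 hr hε hmem, fun x y c => ⟨?_, fun c' hc' => ?_⟩,
      fun x c => ⟨?_, fun y c' hc' => ?_⟩⟩⟩
  · obtain ⟨c', hc'⟩ := exists_isShortestInClass hgeo hr0 hr c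
    -- A minimizer may have an arbitrary parametrization; its constant speed version is still
    -- shortest in the class and serves as the witness.
    obtain h | ⟨g, h1, -, h2⟩ := hc'.constant_or_exists hgeo hr0 hr
    · exact ⟨c', hc', Or.inl h⟩
    · exact ⟨g, h2, Or.inr h1⟩
  · exact (hc'.constant_or_exists hgeo hr0 hr).imp_right fun ⟨g, h1, h2, _⟩ => ⟨g, h1, h2⟩
  · obtain ⟨y, c', hc'⟩ := exists_isShortestInFreeClass hgeo hr0 hr c
    obtain h | ⟨g, h1, -, h2⟩ := hc'.constant_or_exists hgeo hr0 hr
    · exact ⟨y, c', hc', Or.inl h⟩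
    · exact ⟨y, g, h2, Or.inr h1⟩
  · exact (hc'.constant_or_exists hgeo hr0 hr).imp_right fun ⟨g, h1, h2, _⟩ => ⟨g, h1, h2⟩
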